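/- Let $p$ be an odd prime, $G=\mathrm{GL}_2(\mathbb{Q}_p)$, $K=\mathrm{GL}_2(\mathbb{Z}_p)$ and $Z$ the centre of $G$. Let $v$ be the valuation of $\bar{\mathbb{Q}}_p$ with $v(p)=1$, let $m_{\bar{\mathbb{Z}}_p}$ be the maximal ideal of $\bar{\mathbb{Z}}_p$, and let $\bar{\mathbb{F}}_p=\bar{\mathbb{Z}}_p/m_{\bar{\mathbb{Z}}_p}$. For a $\mathbb{Z}_p$-algebra $R$ and $r\ge 0$ let $\mathrm{Sym}^rR^2$ be the space of homogeneous polynomials of degree $r$ in $X,Y$ over $R$, on which $\left(\begin{smallmatrix}a&b\\c&d\end{smallmatrix}\right)\in K$ acts by $w(X,Y)\mapsto w(aX+cY,bX+dY)$ and $p\in Z$ acts trivially. For a representation $W$ of $KZ$ let $\mathrm{ind}_{KZ}^GW$ be the space of functions $f:G\to W$ with $f(hx)=h\cdot f(x)$ for $h\in KZ$ that are compactly supported modulo $KZ$, with $G$ acting by right translation, and let $[g,w]$ be the function supported on $KZg^{-1}$ with $[g,w](x)=xg\cdot w$ there. Let $T$ be the $G$-equivariant Hecke operator on $\mathrm{ind}_{KZ}^G\mathrm{Sym}^rR^2$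 given by $$T[g,w(X,Y)]=\sum_{\lambda\in\mathbb{F}_p}\Big[g\left(\begin{smallmatrix}p&[\lambda]\\0&1\end{smallmatrix}\right),\,w(X,-[\lambda]X+pY)\Big]+\Big[g\left(\begin{smallmatrix}1&0\\0&p\end{smallmatrix}\right),\,w(pX,Y)\Big],$$ where $[\lambda]$ is the Teichmüller representative of $\lambda$. For $k\ge 2$, $r=k-2$ and $a_p\in m_{\bar{\mathbb{Z}}_p}$ let $\Theta_{k,a_p}$ be the image of $\mathrm{ind}_{KZ}^G\mathrm{Sym}^r\bar{\mathbb{Z}}_p^2$ in $\mathrm{ind}_{KZ}^G\mathrm{Sym}^r\bar{\mathbb{Q}}_p^2/(T-a_p)$, and let $\bar\Theta_{k,a_p}=\Theta_{k,a_p}\otimes_{\bar{\mathbb{Z}}_p}\bar{\mathbb{F}}_p$. Let $V_r=\mathrm{Sym}^r\bar{\mathbb{F}}_p^2$, and let $V_r^{(1)}\subseteq V_r$ be the subrepresentation of polynomials divisible by $\theta=X^pY-Y^pX$. Let $a_p\in m_{\bar{\mathbb{Z}}_p}$ be non-zero and let $k\ge 2$, $b\ge 0$, $t\ge 0$ be integers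 such that $r=k-2\equiv b \bmod p^t(p-1)$, $2v(a_p)\le b\le p-1$ and $t>2v(a_p)-1$. In the case $2v(a_p)=b$ assume further that $b$ is odd and that $p^{-b/2}a_p\not\equiv\pm1\bmod m_{\bar{\mathbb{Z}}_p}$. Then there is a $G$-equivariant $\bar{\mathbb{F}}_p$-linear surjection $$\mathrm{ind}_{KZ}^G\big(V_r/V_r^{(1)}\big)\twoheadrightarrow\bar\Theta_{k,a_p},$$ and it can be chosen to be induced by the natural map $\mathrm{ind}_{KZ}^G\mathrm{Sym}^r\bar{\mathbb{Z}}_p^2\to\bar\Theta_{k,a_p}$: it sends $[g,\,\bar w \bmod V_r^{(1)}]$ to the class of $[g,w]$ for all $g\in G$ and $w\in\mathrm{Sym}^r\bar{\mathbb{Z}}_p^2$ with reduction $\bar w\in V_r$. -/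

import Mathlib

open scoped TensorProduct MatrixGroups

noncomputable section

open MvPolynomial


section CompactInduction

variable {R : Type*} [CommRing R] {G : Type*} [Group G] (H : Subgroup G)
  {W : Type*} [AddCommGroup W] [Module R W] (ρ : Representation R H W)

/-- The compact induction `ind_H^G W` for an open subgroup `H` of `G`: the functions `f : G → W`
with `f (h x) = ρ h (f x)` whose support is contained in finitely many cosets `H g`
(that is, is compact modulo `H`). -/
def cInd : Submodule R (G → W) where
  carrier := {f | (∀ (h : H) (x : G), f (h * x) = ρ h (f x)) ∧
    ∃ s : Finset G, ∀ x, f x ≠ 0 → ∃ g ∈ s, x * g⁻¹ ∈ H}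
  zero_mem' := ⟨fun h x => by simp, ∅, fun x hx => absurd rfl hx⟩
  add_mem' := by
    classical
    rintro f₁ f₂ ⟨h₁, s₁, hs₁⟩ ⟨h₂, s₂, hs₂⟩
    refine ⟨fun h x => by simp [h₁, h₂], s₁ ∪ s₂, fun x hx => ?_⟩
    by_cases hx₁ : f₁ x = 0
    · have hx₂ : f₂ x ≠ 0 := fun h0 => hx (by simp [hx₁, h0])
      obtain ⟨g, hg, hxg⟩ := hs₂ x hx₂
      exact ⟨g, Finset.mem_union_right _ hg, hxg⟩
    · obtain ⟨g, hg, hxg⟩ := hs₁ x hx₁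
      exact ⟨g, Finset.mem_union_left _ hg, hxg⟩
  smul_mem' := by
    rintro c f ⟨h₁, s₁, hs₁⟩
    refine ⟨fun h x => by simp [h₁], s₁, fun x hx => hs₁ x fun h0 => hx (by simp [h0])⟩

namespace cInd

/-- The action of `G` on `ind_H^G W` by right translation, `(g f)(x) = f (x g)`. -/
def rep : Representation R G (cInd H ρ) where
  toFun g :=
    { toFun := fun f => ⟨fun x => f.1 (x * g), fun h x => by
          change f.1 (h * x * g) = ρ h (f.1 (x * g))
          rw [mul_assoc]; exact f.2.1 h (x * g), by
        classical
        obtain ⟨s, hs⟩ := f.2.2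
        refine ⟨s.image (· * g⁻¹), fun x hx => ?_⟩
        obtain ⟨y, hy, hxy⟩ := hs _ hx
        exact ⟨y * g⁻¹, Finset.mem_image_of_mem _ hy, by simpa [mul_assoc] using hxy⟩⟩
      map_add' := fun _ _ => rfl
      map_smul' := fun _ _ => rfl }
  map_one' := by ext f x; simp
  map_mul' g₁ g₂ := by ext f x; simp [mul_assoc]

open Classical in
/-- The elementary function `[g, w]`, supported on `H g⁻¹`, with `[g, w](x) = (x g) w` there. -/
def single (g : G) : W →ₗ[R] cInd H ρ where
  toFun w := ⟨fun x => if h : x * g ∈ H then ρ ⟨x * g, h⟩ w else 0, fun h x => by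
      by_cases hx : x * g ∈ H
      · have hx' : (h : G) * x * g ∈ H := by
          rw [mul_assoc]; exact H.mul_mem h.2 hx
        have e : (⟨(h : G) * x * g, hx'⟩ : H) = h * ⟨x * g, hx⟩ :=
          Subtype.ext (mul_assoc _ _ _)
        simp only [dif_pos hx, dif_pos hx', e, map_mul, Module.End.mul_apply]
      · have hx' : (h : G) * x * g ∉ H := fun h' =>
          hx ((H.mul_mem_cancel_left h.2).1 (by rwa [← mul_assoc]))
        simp only [dif_neg hx, dif_neg hx', map_zero],
    {g⁻¹}, fun x hx => ⟨g⁻¹, Finset.mem_singleton_self _, by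
      by_contra hc
      exact hx (dif_neg (by simpa using hc))⟩⟩
  map_add' v w := by
    ext x
    by_cases hx : x * g ∈ H <;> simp [hx]
  map_smul' c w := by
    ext x
    by_cases hx : x * g ∈ H <;> simp [hx]

open Classical in
theorem single_apply (g : G) (w : W) (x : G) :
    (single H ρ g w).1 x = if h : x * g ∈ H then ρ ⟨x * g, h⟩ w else 0 := rfl

theorem rep_single (g g' : G) (w : W) :
    rep H ρ g (single H ρ g' w) = single H ρ (g * g') w := by
  ext x
  change (single H ρ g' w).1 (x * g) = (single H ρ (g * g') w).1 x
  rw [single_apply, single_apply]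
  have e : x * g * g' = x * (g * g') := mul_assoc _ _ _
  by_cases hx : x * (g * g') ∈ H
  · rw [dif_pos hx, dif_pos (by rwa [e])]
    simp only [e]
  · rw [dif_neg hx, dif_neg (by rwa [e])]

theorem single_mul (g : G) (h : H) (w : W) :
    single H ρ (g * h) w = single H ρ g (ρ h w) := by
  ext x
  rw [single_apply, single_apply]
  by_cases hx : x * g ∈ H
  · have hx' : x * (g * h) ∈ H := by rw [← mul_assoc]; exact H.mul_mem hx h.2
    have e : (⟨x * (g * h), hx'⟩ : H) = ⟨x * g, hx⟩ * h := Subtype.ext (mul_assoc _ _ _).symm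
    rw [dif_pos hx, dif_pos hx', e, map_mul, Module.End.mul_apply]
  · have hx' : x * (g * h) ∉ H := fun h' =>
      hx ((H.mul_mem_cancel_right h.2).1 (by rwa [mul_assoc]))
    rw [dif_neg hx, dif_neg hx']

theorem apply_mul {f : G → W} (hf : f ∈ cInd H ρ) (h : H) (x : G) : f (h * x) = ρ h (f x) :=
  hf.1 h x

theorem finite_support (f : cInd H ρ) :
    {c : G ⧸ H | f.1 c.out⁻¹ ≠ 0}.Finite := by
  classical
  obtain ⟨s, hs⟩ := f.2.2
  refine (s.image fun g => ((g⁻¹ : G) : G ⧸ H)).finite_toSet.subset fun c hc => ?_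
  obtain ⟨g, hg, hcg⟩ := hs _ hc
  refine Finset.mem_coe.2 (Finset.mem_image.2 ⟨g, hg, ?_⟩)
  rw [← QuotientGroup.out_eq' c, eq_comm, QuotientGroup.eq]
  exact hcg

variable {N : Type*} [AddCommGroup N] [Module R N]

/-- The linear map out of `ind_H^G W` with prescribed values `[g, w] ↦ Φ g w` on the elementary
functions, where `Φ (g h) w = Φ g (h w)` for `h ∈ H`. -/
def lift (Φ : G → W →ₗ[R] N) (_hΦ : ∀ (g : G) (h : H) (w : W), Φ (g * h) w = Φ g (ρ h w)) :
    cInd H ρ →ₗ[R] N where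
  toFun f := ∑ᶠ c : G ⧸ H, Φ c.out (f.1 c.out⁻¹)
  map_add' f₁ f₂ := by
    rw [← finsum_add_distrib]
    · exact finsum_congr fun c => map_add _ _ _
    · exact (finite_support H ρ f₁).subset fun c hc h0 => hc (by simp [h0])
    · exact (finite_support H ρ f₂).subset fun c hc h0 => hc (by simp [h0])
  map_smul' a f := by
    rw [RingHom.id_apply, smul_finsum' a]
    · exact finsum_congr fun c => map_smul _ _ _
    · exact (finite_support H ρ f).subset fun c hc h0 => hc (by simp [h0])

theorem lift_single (Φ : G → W →ₗ[R] N)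
    (hΦ : ∀ (g : G) (h : H) (w : W), Φ (g * h) w = Φ g (ρ h w)) (g : G) (w : W) :
    lift H ρ Φ hΦ (single H ρ g w) = Φ g w := by
  change ∑ᶠ c : G ⧸ H, Φ c.out ((single H ρ g w).1 c.out⁻¹) = Φ g w
  have hg : ((g : G ⧸ H).out)⁻¹ * g ∈ H := by
    rw [← QuotientGroup.eq]; exact QuotientGroup.out_eq' _
  rw [finsum_eq_single _ (g : G ⧸ H)]
  · rw [single_apply, dif_pos hg, ← hΦ]
    simp
  · intro c hc
    rw [single_apply, dif_neg, map_zero]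
    intro h
    exact hc (by rw [← QuotientGroup.out_eq' c]; exact QuotientGroup.eq.2 h)

/-- Every element of `ind_H^G W` is a finite sum of elementary functions. -/
theorem eq_lift_single (f : cInd H ρ) :
    f = lift H ρ (single H ρ) (single_mul H ρ) f := by
  apply Subtype.ext
  funext x
  have hfin : (Function.support fun c : G ⧸ H =>
      single H ρ c.out (f.1 c.out⁻¹)).Finite :=
    (finite_support H ρ f).subset fun c hc h0 => hc (by simp [h0])
  let ev : cInd H ρ →+ W :=
    { toFun := fun f => f.1 x, map_zero' := rfl, map_add' := fun _ _ => rfl }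
  change f.1 x = ev (∑ᶠ c : G ⧸ H, single H ρ c.out (f.1 c.out⁻¹))
  rw [ev.map_finsum hfin]
  change f.1 x = ∑ᶠ c : G ⧸ H, (single H ρ c.out (f.1 c.out⁻¹)).1 x
  have hx : x * ((x⁻¹ : G) : G ⧸ H).out ∈ H := by
    have : (x⁻¹)⁻¹ * ((x⁻¹ : G) : G ⧸ H).out ∈ H := by
      rw [← QuotientGroup.eq]; exact (QuotientGroup.out_eq' _).symm
    simpa using this
  rw [finsum_eq_single _ ((x⁻¹ : G) : G ⧸ H)]
  · rw [single_apply, dif_pos hx, ← f.2.1]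
    simp
  · intro c hc
    rw [single_apply, dif_neg]
    intro h
    refine hc ?_
    rw [← QuotientGroup.out_eq' c]
    exact (QuotientGroup.eq.2 (by simpa using h)).symm

theorem hom_ext {F₁ F₂ : cInd H ρ →ₗ[R] N}
    (h : ∀ g w, F₁ (single H ρ g w) = F₂ (single H ρ g w)) : F₁ = F₂ := by
  ext f
  rw [eq_lift_single H ρ f]
  have hfin : (Function.support fun c : G ⧸ H =>
      single H ρ c.out (f.1 c.out⁻¹)).Finite :=
    (finite_support H ρ f).subset fun c hc h0 => hc (by simp [h0])
  change F₁.toAddMonoidHom (∑ᶠ c : G ⧸ H, single H ρ c.out (f.1 c.out⁻¹)) =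
    F₂.toAddMonoidHom (∑ᶠ c : G ⧸ H, single H ρ c.out (f.1 c.out⁻¹))
  rw [AddMonoidHom.map_finsum _ hfin, AddMonoidHom.map_finsum _ hfin]
  exact finsum_congr fun c => h _ _

end cInd

end CompactInduction
section
variable (p : ℕ) [Fact p.Prime]

/-- `K → G`, where `K = GL₂(ℤ_p)`, `G = GL₂(ℚ_p)`. -/
def inclK : GL (Fin 2) ℤ_[p] →* GL (Fin 2) ℚ_[p] :=
  Matrix.GeneralLinearGroup.map (algebraMap ℤ_[p] ℚ_[p])

/-- The subgroup `KZ` of `GL₂(ℚ_p)`, with `Z` the centre. -/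
def KZ : Subgroup (GL (Fin 2) ℚ_[p]) :=
  (inclK p).range ⊔ Subgroup.center (GL (Fin 2) ℚ_[p])

def pUnit : ℚ_[p]ˣ := Units.mk0 (p : ℚ_[p]) (by exact_mod_cast (Fact.out : p.Prime).ne_zero)

/-- The homomorphism `K × ℤ → G`, `(k, n) ↦ k pⁿ`. -/
def kpHom : GL (Fin 2) ℤ_[p] × Multiplicative ℤ →* GL (Fin 2) ℚ_[p] where
  toFun x := inclK p x.1 * Matrix.GeneralLinearGroup.scalar (Fin 2) (pUnit p ^ x.2.toAdd)
  map_one' := by simp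
  map_mul' x y := by
    have hc : Matrix.GeneralLinearGroup.scalar (Fin 2) (pUnit p ^ x.2.toAdd) ∈
        Subgroup.center (GL (Fin 2) ℚ_[p]) := by
      rw [Matrix.GeneralLinearGroup.center_eq_range_scalar]; exact ⟨_, rfl⟩
    have h := Subgroup.mem_center_iff.1 hc (inclK p y.1)
    simp only [Prod.fst_mul, Prod.snd_mul, toAdd_mul, zpow_add, map_mul]
    rw [mul_assoc, ← mul_assoc (inclK p y.1), h]
    simp only [mul_assoc]

theorem inclK_det_norm (k : GL (Fin 2) ℤ_[p]) : ‖((inclK p k : GL (Fin 2) ℚ_[p]) : Matrix (Fin 2) (Fin 2) ℚ_[p]).det‖ = 1 := by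
  have h : ((inclK p k : GL (Fin 2) ℚ_[p]) : Matrix (Fin 2) (Fin 2) ℚ_[p]).det
      = algebraMap ℤ_[p] ℚ_[p] (k : Matrix (Fin 2) (Fin 2) ℤ_[p]).det := by
    rw [RingHom.map_det]; rfl
  rw [h]
  exact PadicInt.isUnit_iff.1 ((Matrix.isUnit_iff_isUnit_det _).1 k.isUnit)

theorem kpHom_injective : Function.Injective (kpHom p) := by
  rw [injective_iff_map_eq_one]
  rintro ⟨k, n⟩ h
  change inclK p k * Matrix.GeneralLinearGroup.scalar (Fin 2) (pUnit p ^ n.toAdd) = 1 at h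
  have hp : (1 : ℝ) < p := by exact_mod_cast (Fact.out : p.Prime).one_lt
  have hn : n.toAdd = 0 := by
    have h' := congrArg (fun g : GL (Fin 2) ℚ_[p] => ‖(g : Matrix (Fin 2) (Fin 2) ℚ_[p]).det‖) h
    simp only [Units.val_mul, Matrix.det_mul, norm_mul, inclK_det_norm] at h'
    have e : ((Matrix.GeneralLinearGroup.scalar (Fin 2) (pUnit p ^ n.toAdd) : GL (Fin 2) ℚ_[p]) :
        Matrix (Fin 2) (Fin 2) ℚ_[p]).det = ((p : ℚ_[p]) ^ n.toAdd) ^ 2 := by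
      change (Matrix.scalar (Fin 2) ((pUnit p ^ n.toAdd : ℚ_[p]ˣ) : ℚ_[p])).det = _
      simp [pUnit]
    rw [e] at h'
    simp only [norm_pow, norm_zpow, Padic.norm_p, one_mul, Units.val_one, Matrix.det_one, norm_one] at h'
    have h2 : (((p : ℝ)⁻¹) ^ n.toAdd) = 1 := by
      rwa [pow_eq_one_iff_of_nonneg (by positivity) two_ne_zero] at h'
    rw [inv_zpow, inv_eq_one, zpow_eq_one_iff_right₀ (by linarith) hp.ne'] at h2
    exact h2
  have hn' : n = 1 := hn
  subst hn'
  simp only [toAdd_one, zpow_zero, map_one, mul_one] at h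
  have hk : k = 1 := by
    ext i j
    have := congrArg (fun g : GL (Fin 2) ℚ_[p] => (g : Matrix (Fin 2) (Fin 2) ℚ_[p]) i j) h
    apply IsFractionRing.injective ℤ_[p] ℚ_[p]
    refine Eq.trans this ?_
    by_cases hij : i = j <;> simp [hij]
  rw [hk]; rfl

theorem KZ_le_range : KZ p ≤ (kpHom p).range := by
  refine sup_le ?_ ?_
  · rintro _ ⟨k, rfl⟩
    exact ⟨(k, 1), by simp [kpHom]⟩
  · rw [Matrix.GeneralLinearGroup.center_eq_range_scalar]
    rintro _ ⟨z, rfl⟩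
    have hu : ‖(z : ℚ_[p]) * (p : ℚ_[p]) ^ (-(z : ℚ_[p]).valuation)‖ = 1 := by
      rw [norm_mul, norm_zpow, Padic.norm_p, Padic.norm_eq_zpow_neg_valuation z.ne_zero, inv_zpow, ← zpow_neg,
        neg_neg, ← zpow_add₀ (by exact_mod_cast (Fact.out : p.Prime).ne_zero), neg_add_cancel,
        zpow_zero]
    refine ⟨(Matrix.GeneralLinearGroup.scalar (Fin 2) (PadicInt.mkUnits hu),
      Multiplicative.ofAdd (z : ℚ_[p]).valuation), ?_⟩
    have e : inclK p (Matrix.GeneralLinearGroup.scalar (Fin 2) (PadicInt.mkUnits hu)) =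
        Matrix.GeneralLinearGroup.scalar (Fin 2) (z * pUnit p ^ (-(z : ℚ_[p]).valuation)) := by
      ext i j
      change ((Matrix.scalar (Fin 2) (PadicInt.mkUnits hu : ℤ_[p]) i j : ℤ_[p]) : ℚ_[p]) =
        Matrix.scalar (Fin 2) ((z * pUnit p ^ (-(z : ℚ_[p]).valuation) : ℚ_[p]ˣ) : ℚ_[p]) i j
      have e2 : ((z * pUnit p ^ (-(z : ℚ_[p]).valuation) : ℚ_[p]ˣ) : ℚ_[p]) =
          (PadicInt.mkUnits hu : ℤ_[p]) := by
        rw [PadicInt.mkUnits_eq, Units.val_mul, Units.val_zpow_eq_zpow_val]; rfl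
      rw [e2]
      generalize (PadicInt.mkUnits hu : ℤ_[p]) = c
      by_cases hij : i = j
      · subst hij
        simp [Matrix.scalar_apply]
      · simp [Matrix.scalar_apply, hij]
    change inclK p _ * Matrix.GeneralLinearGroup.scalar (Fin 2) (pUnit p ^ (z : ℚ_[p]).valuation) = _
    rw [e, ← map_mul, mul_assoc, ← zpow_add, neg_add_cancel, zpow_zero, mul_one]

/-- The projection `KZ = K × p^ℤ → K`. -/
def KZtoK : KZ p →* GL (Fin 2) ℤ_[p] :=
  (MonoidHom.fst _ _).comp
    ((MonoidHom.ofInjective (kpHom_injective p)).symm.toMonoidHom.comp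
      (Subgroup.inclusion (KZ_le_range p)))

theorem KZtoK_spec (h : KZ p) : ∃ n : ℤ,
    (h : GL (Fin 2) ℚ_[p]) = inclK p (KZtoK p h) * Matrix.GeneralLinearGroup.scalar (Fin 2) (pUnit p ^ n) := by
  obtain ⟨x, hx⟩ : ∃ x, (MonoidHom.ofInjective (kpHom_injective p)) x =
    Subgroup.inclusion (KZ_le_range p) h := (MonoidHom.ofInjective (kpHom_injective p)).surjective _
  refine ⟨x.2.toAdd, ?_⟩
  have h1 : KZtoK p h = x.1 := by
    simp [KZtoK, ← hx]
  rw [h1]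
  exact (congrArg Subtype.val hx).symm

theorem KZtoK_unique (h : KZ p) (k : GL (Fin 2) ℤ_[p]) (n : ℤ) (e : 
    (h : GL (Fin 2) ℚ_[p]) = inclK p k * Matrix.GeneralLinearGroup.scalar (Fin 2) (pUnit p ^ n)) :
    KZtoK p h = k := by
  obtain ⟨m, hm⟩ := KZtoK_spec p h
  have := kpHom_injective p (a₁ := (KZtoK p h, Multiplicative.ofAdd m)) (a₂ := (k, Multiplicative.ofAdd n)) (hm.symm.trans e)
  exact congrArg Prod.fst this
end

/-- The Teichmüller representative `[l] ∈ ℤ_p` of `l ∈ 𝔽_p`. -/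
def teich (p : ℕ) [Fact p.Prime] (l : ZMod p) : ℤ_[p] :=
  WittVector.equiv p (WittVector.teichmuller p l)

theorem toZMod_teich (p : ℕ) [Fact p.Prime] (l : ZMod p) :
    PadicInt.toZMod (teich p l) = l := by
  have h : WittVector.teichmuller p l - (l.val : WittVector p (ZMod p)) ∈
      RingHom.ker (WittVector.constantCoeff : WittVector p (ZMod p) →+* ZMod p) := by
    rw [RingHom.mem_ker, map_sub, map_natCast, ZMod.natCast_zmod_val]
    simp [WittVector.constantCoeff]
  rw [WittVector.ker_constantCoeff, Ideal.mem_span_singleton] at h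
  obtain ⟨y, hy⟩ := h
  have := congrArg (fun z => PadicInt.toZMod (WittVector.equiv p z)) hy
  simp only [map_sub, map_mul, map_natCast, ZMod.natCast_zmod_val, CharP.cast_eq_zero,
    zero_mul] at this
  exact sub_eq_zero.1 this

section Sym
variable {p : ℕ} [Fact p.Prime] (R : Type*) [CommRing R] [Algebra ℤ_[p] R] (r : ℕ)

/-- `Sym^r R²`, modelled on the homogeneous polynomials of degree `r` in `X = X 0`, `Y = X 1`. -/
def SymPow (R : Type*) [CommRing R] (r : ℕ) : Type _ := homogeneousSubmodule (Fin 2) R r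

instance SymPow.instAddCommGroup (R : Type*) [CommRing R] (r : ℕ) : AddCommGroup (SymPow R r) :=
  inferInstanceAs (AddCommGroup (homogeneousSubmodule (Fin 2) R r))

instance SymPow.instModule (R : Type*) [CommRing R] (r : ℕ) : Module R (SymPow R r) :=
  inferInstanceAs (Module R (homogeneousSubmodule (Fin 2) R r))

instance (priority := low) SymPow.instModuleOfAlgebra (A R : Type*) [CommRing A] [CommRing R]
    [Algebra A R] (r : ℕ) : Module A (SymPow R r) :=
  inferInstanceAs (Module A (homogeneousSubmodule (Fin 2) R r))

instance SymPow.instIsScalarTower (A R : Type*) [CommRing A] [CommRing R]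
    [Algebra A R] (r : ℕ) : IsScalarTower A R (SymPow R r) :=
  inferInstanceAs (IsScalarTower A R (homogeneousSubmodule (Fin 2) R r))

/-- The underlying polynomial of an element of `Sym^r R²`. -/
def SymPow.poly {R : Type*} [CommRing R] {r : ℕ} : SymPow R r →ₗ[R] MvPolynomial (Fin 2) R :=
  (homogeneousSubmodule (Fin 2) R r).subtype

theorem SymPow.ext {R : Type*} [CommRing R] {r : ℕ} {v w : SymPow R r} (h : v.poly = w.poly) :
    v = w := Subtype.ext h

/-- The substitution `v(X, Y) ↦ v(aX + cY, bX + dY)` given by a matrix `(a b; c d)`. -/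
def substXY (M : Matrix (Fin 2) (Fin 2) ℤ_[p]) :
    MvPolynomial (Fin 2) R →ₐ[R] MvPolynomial (Fin 2) R :=
  aeval ![C (algebraMap ℤ_[p] R (M 0 0)) * X 0 + C (algebraMap ℤ_[p] R (M 1 0)) * X 1,
    C (algebraMap ℤ_[p] R (M 0 1)) * X 0 + C (algebraMap ℤ_[p] R (M 1 1)) * X 1]

theorem substXY_mem (M : Matrix (Fin 2) (Fin 2) ℤ_[p]) {v : MvPolynomial (Fin 2) R}
    (hv : v ∈ homogeneousSubmodule (Fin 2) R r) :
    substXY R M v ∈ homogeneousSubmodule (Fin 2) R r := by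
  rw [mem_homogeneousSubmodule] at hv ⊢
  have := IsHomogeneous.aeval (R := R) (S := R) hv (![C (algebraMap ℤ_[p] R (M 0 0)) * X 0 + C (algebraMap ℤ_[p] R (M 1 0)) * X 1,
    C (algebraMap ℤ_[p] R (M 0 1)) * X 0 + C (algebraMap ℤ_[p] R (M 1 1)) * X 1] : Fin 2 → MvPolynomial (Fin 2) R) (n := 1) (by
      intro i
      fin_cases i
      · exact ((isHomogeneous_X R 0).C_mul _).add ((isHomogeneous_X R 1).C_mul _)
      · exact ((isHomogeneous_X R 0).C_mul _).add ((isHomogeneous_X R 1).C_mul _))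
  rwa [one_mul] at this

/-- The action `v(X, Y) ↦ v(aX + cY, bX + dY)` of matrices `(a b; c d)` on `Sym^r R²`. -/
def symAct : Matrix (Fin 2) (Fin 2) ℤ_[p] →* Module.End R (SymPow R r) where
  toFun M :=
    { toFun := fun v => ⟨substXY R M v.poly, substXY_mem R r M v.2⟩
      map_add' := fun v w => SymPow.ext (map_add (substXY R M) v.poly w.poly)
      map_smul' := fun c v => SymPow.ext (map_smul (substXY R M) c v.poly) }
  map_one' := by
    have h : substXY R (1 : Matrix (Fin 2) (Fin 2) ℤ_[p]) = AlgHom.id R _ := by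
      ext i
      fin_cases i <;> simp [substXY]
    exact LinearMap.ext fun v => SymPow.ext (DFunLike.congr_fun h v.poly)
  map_mul' M N := by
    have h : substXY R (M * N) = (substXY R M).comp (substXY R N) := by
      apply MvPolynomial.algHom_ext
      intro i
      fin_cases i <;>
        simp [substXY, Matrix.mul_apply, Fin.sum_univ_two, MvPolynomial.algebraMap_eq] <;> ring
    exact LinearMap.ext fun v => SymPow.ext (DFunLike.congr_fun h v.poly)

theorem symAct_poly (M : Matrix (Fin 2) (Fin 2) ℤ_[p]) (v : SymPow R r) :
    (symAct R r M v).poly = substXY R M v.poly := rfl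

end Sym

section Hecke

variable (p : ℕ) [Fact p.Prime]

theorem p_ne_zero_Qp : (p : ℚ_[p]) ≠ 0 := by exact_mod_cast (Fact.out : p.Prime).ne_zero

/-- The matrix `(p [l]; 0 1)`. -/
def gMat (l : ZMod p) : GL (Fin 2) ℚ_[p] :=
  Matrix.GeneralLinearGroup.mkOfDetNeZero !![(p : ℚ_[p]), (teich p l : ℚ_[p]); 0, 1]
    (by simpa [Matrix.det_fin_two] using p_ne_zero_Qp p)

/-- The matrix `(1 0; 0 p)`. -/
def alphaMat : GL (Fin 2) ℚ_[p] :=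
  Matrix.GeneralLinearGroup.mkOfDetNeZero !![1, 0; 0, (p : ℚ_[p])]
    (by simpa [Matrix.det_fin_two] using p_ne_zero_Qp p)

/-- The matrices `(p [l]; 0 1)` and `(1 0; 0 p)` over `ℤ_p`. -/
def intMat : Option (ZMod p) → Matrix (Fin 2) (Fin 2) ℤ_[p]
  | some l => !![(p : ℤ_[p]), teich p l; 0, 1]
  | none => !![1, 0; 0, (p : ℤ_[p])]

/-- `p` times the inverses of the matrices `intMat`. -/
def adjMat : Option (ZMod p) → Matrix (Fin 2) (Fin 2) ℤ_[p]
  | some l => !![1, -teich p l; 0, (p : ℤ_[p])]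
  | none => !![(p : ℤ_[p]), 0; 0, 1]

/-- The matrices `intMat` in `GL₂(ℚ_p)`. -/
def optMat : Option (ZMod p) → GL (Fin 2) ℚ_[p]
  | some l => gMat p l
  | none => alphaMat p

theorem optMat_coe (i : Option (ZMod p)) :
    (optMat p i : Matrix (Fin 2) (Fin 2) ℚ_[p]) = (intMat p i).map (algebraMap ℤ_[p] ℚ_[p]) := by
  cases i <;> ext a b <;> fin_cases a <;> fin_cases b <;>
    simp [optMat, gMat, alphaMat, intMat, Matrix.GeneralLinearGroup.mkOfDetNeZero,
      Matrix.GeneralLinearGroup.mk', Matrix.unitOfDetInvertible]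

theorem intMat_mul_adjMat (i : Option (ZMod p)) :
    intMat p i * adjMat p i = (p : ℤ_[p]) • (1 : Matrix (Fin 2) (Fin 2) ℤ_[p]) := by
  cases i <;> ext a b <;> fin_cases a <;> fin_cases b <;>
    simp [intMat, adjMat, mul_comm]

theorem adjMat_mul_intMat (i : Option (ZMod p)) :
    adjMat p i * intMat p i = (p : ℤ_[p]) • (1 : Matrix (Fin 2) (Fin 2) ℤ_[p]) := by
  cases i <;> ext a b <;> fin_cases a <;> fin_cases b <;>
    simp [intMat, adjMat]

theorem det_intMat (i : Option (ZMod p)) : (intMat p i).det = p := by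
  cases i <;> simp [intMat, Matrix.det_fin_two]

theorem p_ne_zero_Zp : (p : ℤ_[p]) ≠ 0 := by exact_mod_cast (Fact.out : p.Prime).ne_zero

theorem p_not_isUnit : ¬ IsUnit (p : ℤ_[p]) := PadicInt.prime_p.not_isUnit

theorem isUnit_or_dvd (x : ℤ_[p]) : IsUnit x ∨ (p : ℤ_[p]) ∣ x := by
  by_cases h : IsUnit x
  · exact Or.inl h
  · right
    have hx : x ∈ IsLocalRing.maximalIdeal ℤ_[p] := h
    rwa [PadicInt.maximalIdeal_eq_span_p, Ideal.mem_span_singleton] at hx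

theorem dvd_iff_toZMod (x : ℤ_[p]) : (p : ℤ_[p]) ∣ x ↔ PadicInt.toZMod x = 0 := by
  rw [← RingHom.mem_ker, PadicInt.ker_toZMod, PadicInt.maximalIdeal_eq_span_p,
    Ideal.mem_span_singleton]

/-- For units `d`, some Teichmüller representative `[l]` satisfies `p ∣ a - [l] d`. -/
theorem exists_teich (a : ℤ_[p]) {d : ℤ_[p]} (hd : IsUnit d) :
    ∃ l : ZMod p, (p : ℤ_[p]) ∣ a - teich p l * d := by
  obtain ⟨u, rfl⟩ := hd
  refine ⟨PadicInt.toZMod (a * (u⁻¹ : ℤ_[p]ˣ)), ?_⟩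
  rw [dvd_iff_toZMod, map_sub, map_mul, toZMod_teich, map_mul, mul_assoc, ← map_mul,
    Units.inv_mul, map_one, mul_one, sub_self]

theorem exists_mat (k : Matrix (Fin 2) (Fin 2) ℤ_[p])
    (i : Option (ZMod p)) :
    ∃ j, ∃ k' : Matrix (Fin 2) (Fin 2) ℤ_[p], k * intMat p i = intMat p j * k' := by
  cases i with
  | some l =>
    rcases isUnit_or_dvd p (k 1 0 * teich p l + k 1 1) with h | ⟨c, hc⟩
    · obtain ⟨m, c, hc⟩ := exists_teich p (k 0 0 * teich p l + k 0 1) h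
      refine ⟨some m, !![k 0 0 - teich p m * k 1 0, c;
        p * k 1 0, k 1 0 * teich p l + k 1 1], ?_⟩
      ext a b
      fin_cases a <;> fin_cases b <;> simp [intMat, Matrix.mul_apply, Fin.sum_univ_two]
      · ring
      · linear_combination hc
      · ring
    · refine ⟨none, !![p * k 0 0, k 0 0 * teich p l + k 0 1; k 1 0, c], ?_⟩
      ext a b
      fin_cases a <;> fin_cases b <;> simp [intMat, Matrix.mul_apply, Fin.sum_univ_two]
      · ring
      · ring
      · linear_combination hc
  | none =>
    rcases isUnit_or_dvd p (k 1 0) with h | ⟨c, hc⟩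
    · obtain ⟨m, c, hc⟩ := exists_teich p (k 0 0) h
      refine ⟨some m, !![c, k 0 1 - teich p m * k 1 1; k 1 0, p * k 1 1], ?_⟩
      ext a b
      fin_cases a <;> fin_cases b <;> simp [intMat, Matrix.mul_apply, Fin.sum_univ_two]
      · linear_combination hc
      · ring
      · ring
    · refine ⟨none, !![k 0 0, p * k 0 1; c, k 1 1], ?_⟩
      ext a b
      fin_cases a <;> fin_cases b <;> simp [intMat, Matrix.mul_apply, Fin.sum_univ_two]
      · ring
      · linear_combination hc
      · ring

theorem intMat_inj {i j : Option (ZMod p)} (u : Matrix (Fin 2) (Fin 2) ℤ_[p])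
    (h : intMat p i = intMat p j * u) : i = j := by
  have h00 := congrFun (congrFun h 0) 0
  have h01 := congrFun (congrFun h 0) 1
  have h10 := congrFun (congrFun h 1) 0
  have h11 := congrFun (congrFun h 1) 1
  cases i with
  | some l =>
    cases j with
    | some m =>
      simp [intMat, Matrix.mul_apply, Fin.sum_univ_two] at h00 h01 h10 h11
      rw [← h11, mul_one] at h01
      have := congrArg PadicInt.toZMod h01
      simpa [toZMod_teich] using this
    | none =>
      simp [intMat, Matrix.mul_apply, Fin.sum_univ_two] at h00 h01 h10 h11
      exact absurd (IsUnit.of_mul_eq_one _ h11.symm) (p_not_isUnit p)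
  | none =>
    cases j with
    | some m =>
      simp [intMat, Matrix.mul_apply, Fin.sum_univ_two] at h00 h01 h10 h11
      rw [← h10, mul_zero, add_zero] at h00
      exact absurd (IsUnit.of_mul_eq_one _ h00.symm) (p_not_isUnit p)
    | none => rfl

theorem exists_perm (k : GL (Fin 2) ℤ_[p]) :
    ∃ (σ : Equiv.Perm (Option (ZMod p))) (k' : Option (ZMod p) → GL (Fin 2) ℤ_[p]),
      ∀ i, (k : Matrix (Fin 2) (Fin 2) ℤ_[p]) * intMat p i =
        intMat p (σ i) * (k' i : Matrix (Fin 2) (Fin 2) ℤ_[p]) := by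
  have hk : IsUnit (k : Matrix (Fin 2) (Fin 2) ℤ_[p]).det :=
    (Matrix.isUnit_iff_isUnit_det _).1 k.isUnit
  choose s m hm using exists_mat p (k : Matrix (Fin 2) (Fin 2) ℤ_[p])
  have hu : ∀ i, IsUnit (m i).det := fun i => by
    have := congrArg Matrix.det (hm i)
    rw [Matrix.det_mul, Matrix.det_mul, det_intMat, det_intMat, mul_comm] at this
    rw [← mul_left_cancel₀ (p_ne_zero_Zp p) this]
    exact hk
  choose k' hk' using fun i => (Matrix.isUnit_iff_isUnit_det _).2 (hu i)
  have hs : Function.Injective s := by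
    intro i j hij
    have hi : (k : Matrix (Fin 2) (Fin 2) ℤ_[p]) * intMat p i = intMat p (s i) * k' i := by
      rw [hk', hm]
    have hj : (k : Matrix (Fin 2) (Fin 2) ℤ_[p]) * intMat p j = intMat p (s j) * k' j := by
      rw [hk', hm]
    refine intMat_inj p (((k' j)⁻¹ * k' i : GL (Fin 2) ℤ_[p]) : Matrix (Fin 2) (Fin 2) ℤ_[p]) ?_
    have e : intMat p (s i) = (k : Matrix (Fin 2) (Fin 2) ℤ_[p]) * intMat p j *
        (((k' j)⁻¹ : GL (Fin 2) ℤ_[p]) : Matrix (Fin 2) (Fin 2) ℤ_[p]) := by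
      rw [hj, mul_assoc, ← Units.val_mul, mul_inv_cancel, Units.val_one, mul_one, hij]
    rw [e, mul_assoc, mul_assoc, ← Units.val_mul] at hi
    have := congrArg (fun z => (((k)⁻¹ : GL (Fin 2) ℤ_[p]) : Matrix (Fin 2) (Fin 2) ℤ_[p]) * z) hi
    simpa only [← mul_assoc, ← Units.val_mul, inv_mul_cancel, Units.val_one, one_mul] using this
  exact ⟨Equiv.ofBijective s (Finite.injective_iff_bijective.1 hs), k', fun i => by
    rw [hk']; exact hm i⟩

variable {p} (R : Type*) [CommRing R] [Algebra ℤ_[p] R] (r : ℕ)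

/-- `Sym^r R²` as a representation of `K`. -/
def symK : Representation R (GL (Fin 2) ℤ_[p]) (SymPow R r) :=
  (symAct R r).comp (Units.coeHom _)

/-- `Sym^r R²` as a representation of `KZ`, with `p ∈ Z` acting trivially. -/
def symKZ : Representation R (KZ p) (SymPow R r) :=
  (symK R r).comp (KZtoK p)

theorem symKZ_apply (h : KZ p) (v : SymPow R r) :
    symKZ R r h v = symAct R r (KZtoK p h : Matrix (Fin 2) (Fin 2) ℤ_[p]) v := rfl

/-- The right-hand side of the formula for `T [g, v]`. -/
def heckeFormula (g : GL (Fin 2) ℚ_[p]) :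
    SymPow R r →ₗ[R] cInd (KZ p) (symKZ R r) :=
  (∑ l : ZMod p, cInd.single (KZ p) (symKZ R r) (g * gMat p l) ∘ₗ
      symAct R r !![1, -teich p l; 0, (p : ℤ_[p])]) +
    cInd.single (KZ p) (symKZ R r) (g * alphaMat p) ∘ₗ symAct R r !![(p : ℤ_[p]), 0; 0, 1]

theorem heckeFormula_eq (g : GL (Fin 2) ℚ_[p]) (v : SymPow R r) :
    heckeFormula R r g v = ∑ i : Option (ZMod p),
      cInd.single (KZ p) (symKZ R r) (g * optMat p i) (symAct R r (adjMat p i) v) := by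
  rw [Fintype.sum_option, add_comm]
  simp [heckeFormula, optMat, adjMat, LinearMap.sum_apply]

theorem heckeFormula_mul (g : GL (Fin 2) ℚ_[p]) (h : KZ p)
    (v : SymPow R r) :
    heckeFormula R r (g * (h : GL (Fin 2) ℚ_[p])) v = heckeFormula R r g (symKZ R r h v) := by
  obtain ⟨n, hn⟩ := KZtoK_spec p h
  obtain ⟨σ, k', hk'⟩ := exists_perm p (KZtoK p h)
  rw [heckeFormula_eq, heckeFormula_eq]
  refine Eq.trans ?_ (Equiv.sum_comp σ _)
  refine Finset.sum_congr rfl fun i _ => ?_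
  have hmem : inclK p (k' i) * Matrix.GeneralLinearGroup.scalar (Fin 2) (pUnit p ^ n) ∈ KZ p := by
    refine Subgroup.mul_mem _ (Subgroup.mem_sup_left ⟨_, rfl⟩) (Subgroup.mem_sup_right ?_)
    rw [Matrix.GeneralLinearGroup.center_eq_range_scalar]
    exact ⟨_, rfl⟩
  have hG : inclK p (KZtoK p h) * optMat p i = optMat p (σ i) * inclK p (k' i) := by
    apply Units.ext
    rw [Units.val_mul, Units.val_mul, optMat_coe, optMat_coe]
    have := congrArg (fun M => M.map (algebraMap ℤ_[p] ℚ_[p])) (hk' i)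
    simp only [Matrix.map_mul] at this
    exact this
  have hc : Matrix.GeneralLinearGroup.scalar (Fin 2) (pUnit p ^ n) * optMat p i =
      optMat p i * Matrix.GeneralLinearGroup.scalar (Fin 2) (pUnit p ^ n) := by
    have : Matrix.GeneralLinearGroup.scalar (Fin 2) (pUnit p ^ n) ∈
        Subgroup.center (GL (Fin 2) ℚ_[p]) := by
      rw [Matrix.GeneralLinearGroup.center_eq_range_scalar]; exact ⟨_, rfl⟩
    exact (Subgroup.mem_center_iff.1 this _).symm
  have hmat : g * (h : GL (Fin 2) ℚ_[p]) * optMat p i = g * optMat p (σ i) *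
      ((⟨_, hmem⟩ : KZ p) : GL (Fin 2) ℚ_[p]) := by
    rw [hn, mul_assoc, mul_assoc, mul_assoc, hc, ← mul_assoc (inclK p _), hG, mul_assoc]
  have hK : KZtoK p ⟨_, hmem⟩ = k' i := KZtoK_unique p _ _ n rfl
  have hA : (k' i : Matrix (Fin 2) (Fin 2) ℤ_[p]) * adjMat p i =
      adjMat p (σ i) * (KZtoK p h : Matrix (Fin 2) (Fin 2) ℤ_[p]) := by
    have h1 := congrArg (fun M => adjMat p (σ i) * M * adjMat p i) (hk' i)
    simp only [mul_assoc, intMat_mul_adjMat] at h1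
    rw [← mul_assoc (adjMat p (σ i)) (intMat p (σ i)), adjMat_mul_intMat] at h1
    simp only [Matrix.mul_smul, Matrix.smul_mul, mul_one, one_mul] at h1
    exact (smul_right_injective _ (p_ne_zero_Zp p) h1).symm
  rw [hmat, cInd.single_mul, symKZ_apply, symKZ_apply, hK, ← Module.End.mul_apply,
    ← Module.End.mul_apply, ← map_mul, ← map_mul, hA]

/-- The Hecke operator `T` on `ind_{KZ}^G Sym^r R²`, defined by
`T [g, v(X, Y)] = ∑_l [g (p [l]; 0 1), v(X, -[l] X + p Y)] + [g (1 0; 0 p), v(p X, Y)]`. -/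
def heckeT : cInd (KZ p) (symKZ R r) →ₗ[R] cInd (KZ p) (symKZ R r) :=
  cInd.lift (KZ p) (symKZ R r) (N := cInd (KZ p) (symKZ R r)) (heckeFormula R r) (heckeFormula_mul R r)

theorem heckeT_single (g : GL (Fin 2) ℚ_[p]) (v : SymPow R r) :
    heckeT R r (cInd.single (KZ p) (symKZ R r) g v) =
      ∑ l : ZMod p, cInd.single (KZ p) (symKZ R r) (g * gMat p l)
          (symAct R r !![1, -teich p l; 0, (p : ℤ_[p])] v) +
        cInd.single (KZ p) (symKZ R r) (g * alphaMat p)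
          (symAct R r !![(p : ℤ_[p]), 0; 0, 1] v) := by
  rw [heckeT, cInd.lift_single (KZ p) (symKZ R r) (N := cInd (KZ p) (symKZ R r))]
  simp [heckeFormula, LinearMap.sum_apply]

theorem heckeT_rep (g : GL (Fin 2) ℚ_[p]) (f : cInd (KZ p) (symKZ R r)) :
    heckeT R r (cInd.rep (KZ p) (symKZ R r) g f) = cInd.rep (KZ p) (symKZ R r) g (heckeT R r f) := by
  have : heckeT R r ∘ₗ cInd.rep (KZ p) (symKZ R r) g =
      cInd.rep (KZ p) (symKZ R r) g ∘ₗ heckeT R r := by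
    refine cInd.hom_ext (KZ p) (symKZ R r) (N := cInd (KZ p) (symKZ R r)) fun g' v => ?_
    simp only [LinearMap.comp_apply, cInd.rep_single, heckeT_single, map_add, map_sum, mul_assoc]
  exact DFunLike.congr_fun this f

variable (p)

/-- The image of `T - a` on `ind_{KZ}^G Sym^r R²`. -/
def heckeImage (a : R) : Submodule R (cInd (KZ p) (symKZ (p := p) R r)) :=
  LinearMap.range (heckeT (p := p) R r - a • LinearMap.id)

/-- `ind_{KZ}^G Sym^r R² / (T - a)`. -/
abbrev heckeQuot (a : R) : Type _ := cInd (KZ p) (symKZ (p := p) R r) ⧸ heckeImage p R r a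

/-- The action of `G` on `ind_{KZ}^G Sym^r R² / (T - a)`. -/
def heckeQuotRep (a : R) : Representation R (GL (Fin 2) ℚ_[p]) (heckeQuot p R r a) :=
  (cInd.rep (KZ p) (symKZ R r)).quotient (heckeImage p R r a) (by
    rintro g _ ⟨f, rfl⟩
    refine ⟨cInd.rep (KZ p) (symKZ R r) g f, ?_⟩
    simp only [LinearMap.sub_apply, LinearMap.smul_apply, LinearMap.id_apply, heckeT_rep,
      map_sub, map_smul])

end Hecke

section Theta

variable (p : ℕ) [Fact p.Prime] (F : Type*) [CommRing F] [Algebra ℤ_[p] F] [CharP F p] (r : ℕ)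

/-- `θ = X^p Y - Y^p X`. -/
def thetaPoly : MvPolynomial (Fin 2) F := X 0 ^ p * X 1 - X 1 ^ p * X 0

/-- `V_r^{(m)}`, the polynomials in `V_r = Sym^r F²` that are divisible by `θ^m`. -/
def thetaSub (m : ℕ) : Submodule F (SymPow F r) where
  carrier := {f | thetaPoly p F ^ m ∣ f.poly}
  zero_mem' := by
    change thetaPoly p F ^ m ∣ SymPow.poly 0
    rw [map_zero]
    exact dvd_zero _
  add_mem' := fun {f g} hf hg => by
    change thetaPoly p F ^ m ∣ SymPow.poly (f + g)
    rw [map_add]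
    exact dvd_add hf hg
  smul_mem' c f hf := by
    obtain ⟨q, hq⟩ := hf
    refine ⟨C c * q, ?_⟩
    rw [map_smul, hq, smul_eq_C_mul]
    ring

theorem algebraMap_pow_p (a : ℤ_[p]) : algebraMap ℤ_[p] F a ^ p = algebraMap ℤ_[p] F a := by
  have h : (p : ℤ_[p]) ∣ a ^ p - a := by
    rw [dvd_iff_toZMod, map_sub, map_pow, ZMod.pow_card, sub_self]
  obtain ⟨c, hc⟩ := h
  have := congrArg (algebraMap ℤ_[p] F) hc
  rw [map_sub, map_pow, map_mul, map_natCast, CharP.cast_eq_zero, zero_mul] at this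
  exact sub_eq_zero.1 this

theorem substXY_theta (M : Matrix (Fin 2) (Fin 2) ℤ_[p]) :
    substXY F M (thetaPoly p F) = C (algebraMap ℤ_[p] F M.det) * thetaPoly p F := by
  have : ExpChar (MvPolynomial (Fin 2) F) p := ExpChar.prime Fact.out
  simp only [thetaPoly, substXY, map_sub, map_mul, map_pow, aeval_X, Matrix.cons_val_zero,
    Matrix.cons_val_one, Matrix.det_fin_two, add_pow_expChar, mul_pow]
  have hC : ∀ a : ℤ_[p], (C (algebraMap ℤ_[p] F a) : MvPolynomial (Fin 2) F) ^ p =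
      C (algebraMap ℤ_[p] F a) := fun a => by rw [← map_pow, algebraMap_pow_p]
  simp only [hC]
  ring

theorem thetaSub_stable (m : ℕ) (k : GL (Fin 2) ℤ_[p]) :
    thetaSub p F r m ≤ (thetaSub p F r m).comap (symK F r k) := by
  rintro f ⟨q, hq⟩
  refine ⟨C (algebraMap ℤ_[p] F (k : Matrix (Fin 2) (Fin 2) ℤ_[p]).det) ^ m *
    substXY F (k : Matrix (Fin 2) (Fin 2) ℤ_[p]) q, ?_⟩
  change substXY F (k : Matrix (Fin 2) (Fin 2) ℤ_[p]) f.poly = _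
  rw [hq, map_mul, map_pow, substXY_theta, mul_pow]
  ring

/-- `V_r / V_r^{(m)}` as a representation of `KZ`, with `p ∈ Z` acting trivially. -/
def quotKZ (m : ℕ) : Representation F (KZ p)
    (SymPow F r ⧸ thetaSub p F r m) :=
  ((symK F r).quotient (thetaSub p F r m) (thetaSub_stable p F r m)).comp (KZtoK p)

end Theta

section BaseChange

variable {p : ℕ} [Fact p.Prime] (R S : Type*) [CommRing R] [CommRing S] [Algebra ℤ_[p] R]
  [Algebra ℤ_[p] S] [Algebra R S] [IsScalarTower ℤ_[p] R S] (r : ℕ)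

/-- The map `Sym^r R² → Sym^r S²` induced by `R → S` on coefficients. -/
def symMap : SymPow R r →ₗ[R] SymPow S r where
  toFun v := ⟨MvPolynomial.map (algebraMap R S) v.poly, IsHomogeneous.map v.2 _⟩
  map_add' v w := SymPow.ext (map_add (MvPolynomial.map (algebraMap R S)) v.poly w.poly)
  map_smul' c v := SymPow.ext (by
    change MvPolynomial.map (algebraMap R S) (c • v.poly) =
      c • MvPolynomial.map (algebraMap R S) v.poly
    rw [smul_eq_C_mul, map_mul, map_C, ← smul_eq_C_mul, algebraMap_smul])

theorem symMap_symAct (M : Matrix (Fin 2) (Fin 2) ℤ_[p]) (v : SymPow R r) :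
    symMap R S r (symAct R r M v) = symAct S r M (symMap R S r v) := by
  apply SymPow.ext
  change MvPolynomial.map (algebraMap R S) (substXY R M v.poly) =
    substXY S M (MvPolynomial.map (algebraMap R S) v.poly)
  generalize v.poly = w
  have h : (MvPolynomial.map (algebraMap R S)).comp (substXY R M).toRingHom =
      ((substXY S M).toRingHom).comp (MvPolynomial.map (algebraMap R S)) := by
    apply MvPolynomial.ringHom_ext
    · intro a
      simp [substXY]
    · intro i
      fin_cases i <;> simp [substXY, ← IsScalarTower.algebraMap_apply ℤ_[p] R S]
  exact DFunLike.congr_fun h w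

/-- The map `ind_{KZ}^G Sym^r R² → ind_{KZ}^G Sym^r S²` induced by `R → S` on coefficients,
`[g, v] ↦ [g, v]`. -/
def indMap : cInd (KZ p) (symKZ R r) →ₗ[R] cInd (KZ p) (symKZ S r) :=
  cInd.lift (KZ p) (symKZ R r) (N := cInd (KZ p) (symKZ S r))
    (fun g => (cInd.single (KZ p) (symKZ S r) g).restrictScalars R ∘ₗ symMap R S r)
    (fun g h w => by
      change cInd.single (KZ p) (symKZ S r) (g * (h : GL (Fin 2) ℚ_[p])) (symMap R S r w) =
        cInd.single (KZ p) (symKZ S r) g (symMap R S r (symKZ R r h w))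
      rw [cInd.single_mul]
      exact congrArg _ (symMap_symAct R S r (KZtoK p h : Matrix (Fin 2) (Fin 2) ℤ_[p]) w).symm)

theorem indMap_single (g : GL (Fin 2) ℚ_[p]) (v : SymPow R r) :
    indMap R S r (cInd.single (KZ p) (symKZ R r) g v) =
      cInd.single (KZ p) (symKZ S r) g (symMap R S r v) :=
  cInd.lift_single (KZ p) (symKZ R r) (N := cInd (KZ p) (symKZ S r)) _ _ g v

/-- `indMap` applies `Sym^r R² → Sym^r S²` to the values of a function. -/
theorem indMap_apply (f : cInd (KZ p) (symKZ R r)) (x : GL (Fin 2) ℚ_[p]) :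
    (indMap R S r f).1 x = symMap R S r (f.1 x) := by
  let ev : cInd (KZ p) (symKZ R r) →ₗ[R] SymPow S r :=
    { toFun := fun f => (indMap R S r f).1 x
      map_add' := fun f₁ f₂ => by rw [map_add]; rfl
      map_smul' := fun c f => by rw [map_smul]; rfl }
  let ev' : cInd (KZ p) (symKZ R r) →ₗ[R] SymPow S r :=
    { toFun := fun f => symMap R S r (f.1 x)
      map_add' := fun f₁ f₂ => map_add (symMap R S r) (f₁.1 x) (f₂.1 x)
      map_smul' := fun c f => map_smul (symMap R S r) c (f.1 x) }
  have h : ev = ev' := by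
    refine cInd.hom_ext (KZ p) (symKZ R r) fun g v => ?_
    change (indMap R S r (cInd.single (KZ p) (symKZ R r) g v)).1 x =
      symMap R S r ((cInd.single (KZ p) (symKZ R r) g v).1 x)
    rw [indMap_single, cInd.single_apply, cInd.single_apply]
    by_cases hx : x * g ∈ KZ p
    · rw [dif_pos hx, dif_pos hx]
      exact (symMap_symAct R S r _ v).symm
    · rw [dif_neg hx, dif_neg hx, map_zero]
  exact DFunLike.congr_fun h f

theorem indMap_rep (g : GL (Fin 2) ℚ_[p]) (f : cInd (KZ p) (symKZ R r)) :
    indMap R S r (cInd.rep (KZ p) (symKZ R r) g f) =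
      cInd.rep (KZ p) (symKZ S r) g (indMap R S r f) := by
  apply Subtype.ext
  funext x
  rw [indMap_apply]
  exact (indMap_apply R S r f (x * g)).symm

end BaseChange

section Reduction

variable (p : ℕ) [Fact p.Prime]

/-- `ℤ̄_p`, the ring of integers of `ℚ̄_p`. -/
abbrev ZpBar : Type := (PadicAlgCl.valued p).v.valuationSubring

/-- `𝔽̄_p`, the residue field of `ℤ̄_p`. -/
abbrev FpBar : Type := IsLocalRing.ResidueField (ZpBar p)

/-- The valuation `v(x)` of a non-zero `x ∈ ℚ̄_p`, normalized by `v(p) = 1`. -/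
def padicVal (x : PadicAlgCl p) : ℝ := -Real.logb p ‖x‖

theorem padicVal_p : padicVal p (p : PadicAlgCl p) = 1 := by
  have h : ‖(p : PadicAlgCl p)‖ = (p : ℝ)⁻¹ := by
    rw [← PadicAlgCl.valuation_coe, PadicAlgCl.valuation_p]; simp
  have hp : (1 : ℝ) < p := by exact_mod_cast (Fact.out : p.Prime).one_lt
  rw [padicVal, h, Real.logb_inv, neg_neg, Real.logb_self_eq_one hp]

theorem norm_algebraMap_le (x : ℤ_[p]) :
    Valued.v (algebraMap ℤ_[p] (PadicAlgCl p) x) ≤ 1 := by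
  rw [PadicAlgCl.valuation_def, ← NNReal.coe_le_coe, coe_nnnorm,
    IsScalarTower.algebraMap_apply ℤ_[p] ℚ_[p] (PadicAlgCl p)]
  exact (PadicAlgCl.norm_extends p _).trans_le (PadicInt.norm_le_one x)

instance algZpBar : Algebra ℤ_[p] (ZpBar p) :=
  ((algebraMap ℤ_[p] (PadicAlgCl p)).codRestrict
    (PadicAlgCl.valued p).v.valuationSubring.toSubring (norm_algebraMap_le p)).toAlgebra

instance towerZpBar : IsScalarTower ℤ_[p] (ZpBar p) (PadicAlgCl p) :=
  IsScalarTower.of_algebraMap_eq fun _ => rfl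

instance charPFpBar : CharP (FpBar p) p := by
  have h : ((p : ℕ) : FpBar p) = 0 := by
    rw [← map_natCast (IsLocalRing.residue (ZpBar p)), IsLocalRing.residue_eq_zero_iff,
      IsLocalRing.mem_maximalIdeal, mem_nonunits_iff]
    intro hu
    rw [← map_natCast (algebraMap ℤ_[p] (ZpBar p))] at hu
    have h1 := (Valuation.integer.integers
      (PadicAlgCl.valued p).v).isUnit_iff_valuation_eq_one.1 hu
    have h2 : Valued.v (p : PadicAlgCl p) = 1 := by
      have e : algebraMap (Valued.integer (PadicAlgCl p)) (PadicAlgCl p)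
          (algebraMap ℤ_[p] (ZpBar p) (p : ℤ_[p])) = (p : PadicAlgCl p) :=
        (map_natCast (algebraMap ℤ_[p] (PadicAlgCl p)) p)
      rw [← e]
      exact h1
    rw [PadicAlgCl.valuation_p] at h2
    have hp : (1 : NNReal) < p := by exact_mod_cast (Fact.out : p.Prime).one_lt
    rw [one_div, inv_eq_one] at h2
    exact hp.ne' h2
  exact (CharP.charP_iff_prime_eq_zero Fact.out).2 h

variable (r : ℕ) (a : PadicAlgCl p)

/-- `Π = ind_{KZ}^G Sym^r ℚ̄_p² / (T - a)`. -/
abbrev PiRep : Type := heckeQuot p (PadicAlgCl p) r a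

/-- The action of `G` on `Π`. -/
abbrev piRep : Representation (PadicAlgCl p) (GL (Fin 2) ℚ_[p]) (PiRep p r a) :=
  heckeQuotRep p (PadicAlgCl p) r a

/-- The natural map `ind_{KZ}^G Sym^r ℤ̄_p² → Π`. -/
def toPi : cInd (KZ p) (symKZ (ZpBar p) r) →ₗ[ZpBar p] PiRep p r a :=
  (heckeImage p (PadicAlgCl p) r a).mkQ.restrictScalars (ZpBar p) ∘ₗ indMap (ZpBar p) (PadicAlgCl p) r

/-- The standard lattice `Θ` in `Π`. -/
def Theta : Submodule (ZpBar p) (PiRep p r a) := LinearMap.range (toPi p r a)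

/-- The action of `G` on `Θ`. -/
def thetaRep : Representation (ZpBar p) (GL (Fin 2) ℚ_[p]) (Theta p r a) where
  toFun g := ((piRep p r a g).restrictScalars (ZpBar p)).restrict (by
    rintro _ ⟨f, rfl⟩
    refine ⟨cInd.rep (KZ p) (symKZ (ZpBar p) r) g f, ?_⟩
    change (heckeImage p (PadicAlgCl p) r a).mkQ (indMap (ZpBar p) (PadicAlgCl p) r
      (cInd.rep (KZ p) (symKZ (ZpBar p) r) g f)) = _
    rw [indMap_rep]
    rfl)
  map_one' := by
    ext x
    change piRep p r a 1 x.1 = x.1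
    rw [map_one]; rfl
  map_mul' g h := by
    ext x
    change piRep p r a (g * h) x.1 = piRep p r a g (piRep p r a h x.1)
    rw [map_mul]; rfl

/-- The reduction `Θ̄ = 𝔽̄_p ⊗ Θ`. -/
abbrev ThetaBar : Type := FpBar p ⊗[ZpBar p] Theta p r a

/-- The action of `G` on `Θ̄`. -/
def thetaBarRep : Representation (FpBar p) (GL (Fin 2) ℚ_[p]) (ThetaBar p r a) where
  toFun g := (thetaRep p r a g).baseChange (FpBar p)
  map_one' := by rw [map_one]; exact LinearMap.baseChange_id
  map_mul' g h := by rw [map_mul]; exact LinearMap.baseChange_mul _ _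

/-- The image in `Θ` of an element of `ind_{KZ}^G Sym^r ℤ̄_p²`. -/
def toTheta : cInd (KZ p) (symKZ (ZpBar p) r) →ₗ[ZpBar p] Theta p r a :=
  (toPi p r a).rangeRestrict

end Reduction

end

/-!
Write `𝔪` for the maximal ideal of `ℤ̄_p`, `v` for the valuation, `[g, w]` also for the class in `Π`
of an elementary function, and `≡` for congruence modulo `𝔪 Θ`. It has to be shown that
`[g, w] ≡ 0` for every integral form `w` whose reduction is divisible by `θ`; the map is then
induced on the quotient by the natural one (`exists_surjection`). Modulo forms with coefficients in
`𝔪` one may take `w = θ q`, and if `r ≤ b` there is nothing to do. So let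
`r = b + p ^ τ (p - 1) n` with `n ≥ 1`, where `τ = min(t, b)`, whence `2 v(a) < τ + 1`; these
numerical facts are recorded in `Admissible`.

In `Π` the Hecke relation `a [g, w] = ∑ [g k_i β, δ k_i⁻¹ w]` holds, where `δ = (1 0; 0 p)`,
`β = (p 0; 0 1)` and `k_i` runs through representatives of `ℙ¹(𝔽_p)` (`cls_rel'`). A form that all
the substitutions `δ k_i⁻¹` annihilate modulo `p ^ τ` therefore has `x [g, w] ≡ 0` whenever
`x p ^ τ / a` lies in `𝔪`. This is combined with three observations.

* A form concentrated at one point of `ℙ¹(𝔽_p)` is mapped by `T` to `X ^ r` at a single neighbour,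
  so that `X ^ r` and its `K`-translates have small class (`smul_cls_pow_mem`).
* Since `b < p`, every monomial `X ^ (b - i) Y ^ i` with `i ≥ 1` is a combination over `ℤ_p` of
  powers `L ^ b` of linear forms (`exists_powPair`). Let `ψ_i` be the same combination of the powers
  `L ^ r`. Because `L ^ (p ^ τ (p - 1))` is modulo `p ^ τ` the indicator function of `L ≠ 0`, the
  form `ψ_i` behaves like `X ^ (b - i) Y ^ i` at all points of `ℙ¹(𝔽_p)`
  (`dvd_substXY_powPair`), whereas `X ^ (r - i) Y ^ i` does so at all points except `X = 0`.
* Consequently `T` annihilates `X ^ (r - i) Y ^ i - ψ_i` modulo `p ^ τ` in all directions but one,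
  and the remaining direction gives `(p ^ i / a) [g, X ^ (r - i) Y ^ i] ≡ -c [g α, U_i]`, where
  `α = (1 0; 0 p)`, `c = p ^ b / a ^ 2` and `U_i = X ^ (b - i) Y ^ (r - b + i) - ψ_i`
  (`smul_cls_mono_add_mem`). The form `U_i` is concentrated at `Y = 0` and looks like
  `-X ^ (b - i) Y ^ i` there.

For `w = θ q` the form `k_i⁻¹ w` is divisible by `Y`, so every neighbour in `(1 / a) T [g, w]`
contributes multiples of `(p ^ i / a) X ^ (r - i) Y ^ i` with `i ≥ 1` only. Moving these back with
the last relation gives `[g, w] ≡ -c [g, S]`, where `S` is assembled from the `U_i`. If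
`2 v(a) < b`, then `c` lies in `𝔪` and the proof is complete. If `2 v(a) = b`, then `S` has at each
point of `ℙ¹(𝔽_p)` the expansion of `-w`, so `w + S` is annihilated by `T` modulo `p ^ τ`, and
`(1 - c) [g, w] ≡ 0`; here `1 - c` is a unit because `a / p ^ (b / 2)` is not congruent to `±1`
(`cls_mem_maxTheta`).
-/

noncomputable section

open MvPolynomial

/-! ### Powers of linear forms modulo powers of `p` -/

section Congruence

variable {p : ℕ} [Fact p.Prime]

theorem dvd_unit_pow_sub_one {u : ℤ_[p]} (hu : IsUnit u) : (p : ℤ_[p]) ∣ u ^ (p - 1) - 1 := by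
  rw [dvd_iff_toZMod, map_sub, map_pow, map_one, ZMod.pow_card_sub_one_eq_one, sub_self]
  exact (hu.map PadicInt.toZMod).ne_zero

variable {A : Type*} [CommRing A] [Algebra ℤ_[p] A]

theorem dvd_of_dvd_padicInt {x : ℤ_[p]} (h : (p : ℤ_[p]) ∣ x) : (p : A) ∣ algebraMap ℤ_[p] A x := by
  simpa using map_dvd (algebraMap ℤ_[p] A) h

/-- A linear form that is a unit times `D` modulo `p` has the same high powers as `D`, because
`u ^ (p - 1) ≡ 1` modulo `p` and `p ^ τ`-th powers gain `τ` digits of precision. -/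
theorem dvd_pow_sub_pow_of_unit {l D : A} {u : ℤ_[p]} (hu : IsUnit u)
    (h : (p : A) ∣ l - algebraMap ℤ_[p] A u * D) (τ n : ℕ) :
    (p : A) ^ τ ∣ l ^ (p ^ τ * (p - 1) * n) - D ^ (p ^ τ * (p - 1) * n) := by
  have h1 : (p : A) ∣ l ^ (p - 1) - D ^ (p - 1) := by
    have h2 := h.trans (sub_dvd_pow_sub_pow l (algebraMap ℤ_[p] A u * D) (p - 1))
    have h3 : (p : A) ∣ (algebraMap ℤ_[p] A u * D) ^ (p - 1) - D ^ (p - 1) := by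
      have := (dvd_of_dvd_padicInt (A := A) (dvd_unit_pow_sub_one hu)).mul_right (D ^ (p - 1))
      rw [map_sub, map_pow, map_one] at this
      rwa [mul_pow, ← sub_one_mul]
    simpa using dvd_add h2 h3
  have h2 := (pow_dvd_pow (p : A) (Nat.le_succ τ)).trans (dvd_sub_pow_of_dvd_sub h1 τ)
  have h3 := h2.trans (sub_dvd_pow_sub_pow _ _ n)
  have e : p ^ τ * (p - 1) * n = (p - 1) * p ^ τ * n := by ring
  rw [e]
  simpa only [← pow_mul] using h3

theorem dvd_pow_sub_mul_pow {l D : A} {u : ℤ_[p]}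
    (h : (p : A) ∣ l - algebraMap ℤ_[p] A u * D) {τ b : ℕ} (hb : τ ≤ b) (n : ℕ) :
    (p : A) ^ τ ∣ l ^ (b + p ^ τ * (p - 1) * n) - D ^ (p ^ τ * (p - 1) * n) * l ^ b := by
  rcases isUnit_or_dvd p u with hu | hu
  · have := (dvd_pow_sub_pow_of_unit hu h τ n).mul_right (l ^ b)
    rw [sub_mul] at this
    rwa [pow_add, mul_comm (l ^ b)]
  · have hl : (p : A) ∣ l := by
      have := dvd_add h ((dvd_of_dvd_padicInt (A := A) hu).mul_right D)
      simpa using this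
    have h1 := pow_dvd_pow_of_dvd_of_le hl hb
    rw [pow_add]
    exact dvd_sub (h1.mul_right _) (h1.mul_left _)

end Congruence

/-! ### Binary forms -/

namespace SymPow

variable {R : Type*} [CommRing R] {r : ℕ}

/-- A homogeneous polynomial of degree `r` as an element of `Sym^r R²`. -/
def ofPoly (f : MvPolynomial (Fin 2) R) (h : f.IsHomogeneous r) : SymPow R r := ⟨f, h⟩

theorem ofPoly_poly (f : MvPolynomial (Fin 2) R) (h : f.IsHomogeneous r) :
    (ofPoly f h).poly = f := rfl

theorem isHomogeneous_poly (w : SymPow R r) : w.poly.IsHomogeneous r := w.2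

/-- The monomial `X ^ i Y ^ j` of degree `i + j = r`. -/
def mono (R : Type*) [CommRing R] {r : ℕ} (i j : ℕ) (h : i + j = r) : SymPow R r :=
  ofPoly (X 0 ^ i * X 1 ^ j) (by
    rw [← h]
    simpa using ((isHomogeneous_X R (0 : Fin 2)).pow i).mul ((isHomogeneous_X R (1 : Fin 2)).pow j))

theorem mono_poly {i j : ℕ} (h : i + j = r) : (mono R i j h).poly = X 0 ^ i * X 1 ^ j := rfl

/-- The coefficient of `X ^ (r - i) Y ^ i`. -/
def coef (w : SymPow R r) (i : ℕ) : R :=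
  w.poly.coeff (Finsupp.single 0 (r - i) + Finsupp.single 1 i)

theorem poly_eq_sum (w : SymPow R r) :
    w.poly = ∑ i ∈ Finset.range (r + 1), C (w.coef i) * (X 0 ^ (r - i) * X 1 ^ i) := by
  have hX : ∀ i, C (w.coef i) * (X 0 ^ (r - i) * X 1 ^ i) =
      monomial (Finsupp.single (0 : Fin 2) (r - i) + Finsupp.single 1 i) (w.coef i) := fun i => by
    rw [X_pow_eq_monomial, X_pow_eq_monomial, monomial_mul, C_mul_monomial]; simp
  simp only [hX]
  ext d
  rw [coeff_sum]
  simp only [coeff_monomial]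
  have hd : ∀ i, Finsupp.single (0 : Fin 2) (r - i) + Finsupp.single 1 i = d ↔
      r - i = d 0 ∧ i = d 1 := fun i => by
    rw [Finsupp.ext_iff, Fin.forall_fin_two]; simp
  by_cases h : d.degree = r
  · have h' : d 0 + d 1 = r := by rw [← h, Finsupp.degree_eq_sum, Fin.sum_univ_two]
    rw [Finset.sum_eq_single (d 1), if_pos ((hd _).2 ⟨by omega, rfl⟩), coef,
      (hd (d 1)).2 ⟨by omega, rfl⟩]
    · intro i _ hi
      rw [if_neg fun hc => hi ((hd i).1 hc).2]
    · intro hc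
      exact absurd (Finset.mem_range.2 (by omega)) hc
  · have hw : w.poly.IsHomogeneous r := w.2
    rw [hw.coeff_eq_zero h, Finset.sum_eq_zero]
    intro i hi
    rw [if_neg]
    intro hc
    apply h
    obtain ⟨h0, h1⟩ := (hd i).1 hc
    rw [Finsupp.degree_eq_sum, Fin.sum_univ_two]
    have := Finset.mem_range.1 hi
    omega

theorem coef_zero_eq_zero {w : SymPow R r} (h : (X 1 : MvPolynomial (Fin 2) R) ∣ w.poly) :
    w.coef 0 = 0 := by
  obtain ⟨q, hq⟩ := h
  rw [coef, hq, mul_comm, coeff_mul_X', if_neg]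
  simp

/-- If a constant divides a form as a polynomial, the quotient can be chosen to be a form. -/
theorem exists_eq_smul {w : SymPow R r} {c : R} (h : C c ∣ w.poly) :
    ∃ z : SymPow R r, w = c • z := by
  obtain ⟨q, hq⟩ := h
  refine ⟨ofPoly _ (homogeneousComponent_isHomogeneous r q), SymPow.ext ?_⟩
  rw [map_smul, ofPoly_poly, smul_eq_C_mul, ← homogeneousComponent_C_mul, ← hq,
    homogeneousComponent_of_mem (isHomogeneous_poly w), if_pos rfl]

end SymPow

/-! ### Substitutions that have rank one modulo `p` -/

section Substitution

variable {p : ℕ} [Fact p.Prime] (R : Type*) [CommRing R] [Algebra ℤ_[p] R]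

theorem substXY_X (M : Matrix (Fin 2) (Fin 2) ℤ_[p]) (j : Fin 2) :
    substXY R M (X j) = algebraMap ℤ_[p] _ (M 0 j) * X 0 + algebraMap ℤ_[p] _ (M 1 j) * X 1 := by
  fin_cases j <;> simp [substXY, MvPolynomial.algebraMap_apply]

theorem substXY_algebraMap (M : Matrix (Fin 2) (Fin 2) ℤ_[p]) (x : ℤ_[p]) :
    substXY R M (algebraMap ℤ_[p] _ x) = algebraMap ℤ_[p] _ x := by
  rw [MvPolynomial.algebraMap_apply]
  exact (substXY R M).commutes _

theorem substXY_mul (M N : Matrix (Fin 2) (Fin 2) ℤ_[p]) (f : MvPolynomial (Fin 2) R) :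
    substXY R (M * N) f = substXY R M (substXY R N f) := by
  have h : substXY R (M * N) = (substXY R M).comp (substXY R N) := by
    apply MvPolynomial.algHom_ext
    intro j
    rw [AlgHom.comp_apply, substXY_X, substXY_X, map_add, map_mul, map_mul, substXY_algebraMap,
      substXY_algebraMap, substXY_X, substXY_X, Matrix.mul_apply, Matrix.mul_apply,
      Fin.sum_univ_two, Fin.sum_univ_two]
    simp only [map_add, map_mul]
    ring
  exact DFunLike.congr_fun h f

/-- The substitution `M` sends every linear form to a multiple of `D` modulo `p`. -/
def RankOneMod (M : Matrix (Fin 2) (Fin 2) ℤ_[p]) (D : MvPolynomial (Fin 2) R) : Prop :=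
  ∀ j, ∃ u : ℤ_[p], (p : MvPolynomial (Fin 2) R) ∣ substXY R M (X j) - algebraMap ℤ_[p] _ u * D

variable {R}

theorem dvd_substXY_X_sub {M : Matrix (Fin 2) (Fin 2) ℤ_[p]} {j : Fin 2}
    (h : (p : ℤ_[p]) ∣ M 1 j) :
    (p : MvPolynomial (Fin 2) R) ∣ substXY R M (X j) - algebraMap ℤ_[p] _ (M 0 j) * X 0 := by
  rw [substXY_X, add_sub_cancel_left]
  exact (dvd_of_dvd_padicInt h).mul_right _

theorem rankOneMod_zero {M : Matrix (Fin 2) (Fin 2) ℤ_[p]} (h : ∀ j, (p : ℤ_[p]) ∣ M 1 j) :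
    RankOneMod R M (X 0) := fun j => ⟨M 0 j, dvd_substXY_X_sub (h j)⟩

theorem rankOneMod_one {M : Matrix (Fin 2) (Fin 2) ℤ_[p]} (h : ∀ j, (p : ℤ_[p]) ∣ M 0 j) :
    RankOneMod R M (X 1) := fun j => ⟨M 1 j, by
  rw [substXY_X, add_sub_cancel_right]
  exact (dvd_of_dvd_padicInt (h j)).mul_right _⟩

end Substitution

/-! ### Comparing degree `b` with degree `r` -/

section PowPairs

/-- The linear correspondence between `Sym^b` and `Sym^r` generated by `L ^ b ↔ L ^ r`, where `L`
runs through the `K`-translates of the linear form `X`. -/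
inductive PowPair (p : ℕ) [Fact p.Prime] {R : Type*} [CommRing R] [Algebra ℤ_[p] R] {b r : ℕ} :
    SymPow R b → SymPow R r → Prop
  | gen (k : GL (Fin 2) ℤ_[p]) :
      PowPair p (symK R b k (SymPow.mono R b 0 rfl)) (symK R r k (SymPow.mono R r 0 rfl))
  | zero : PowPair p 0 0
  | add {s s' : SymPow R b} {ψ ψ' : SymPow R r} :
      PowPair p s ψ → PowPair p s' ψ' → PowPair p (s + s') (ψ + ψ')
  | smul (c : R) {s : SymPow R b} {ψ : SymPow R r} :
      PowPair p s ψ → PowPair p (c • s) (c • ψ)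

theorem PowPair.of_eq {p : ℕ} [Fact p.Prime] {R : Type*} [CommRing R] [Algebra ℤ_[p] R] {b r : ℕ}
    {s s' : SymPow R b} {ψ : SymPow R r} (h : PowPair p s ψ) (e : s = s') : PowPair p s' ψ :=
  e ▸ h

theorem PowPair.sum {p : ℕ} [Fact p.Prime] {R : Type*} [CommRing R] [Algebra ℤ_[p] R] {b r : ℕ}
    {ι : Type*} (t : Finset ι) {f : ι → SymPow R b} {g : ι → SymPow R r}
    (h : ∀ i, PowPair p (f i) (g i)) : PowPair p (∑ i ∈ t, f i) (∑ i ∈ t, g i) := by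
  classical
  induction t using Finset.induction_on with
  | empty => exact .zero
  | insert i t hi ih =>
    rw [Finset.sum_insert hi, Finset.sum_insert hi]
    exact (h i).add ih

variable {p : ℕ} [Fact p.Prime] {R : Type*} [CommRing R] [Algebra ℤ_[p] R] {b r : ℕ}

theorem symK_poly (k : GL (Fin 2) ℤ_[p]) (w : SymPow R r) :
    (symK R r k w).poly = substXY R (k : Matrix (Fin 2) (Fin 2) ℤ_[p]) w.poly := rfl

theorem symK_mono_poly (k : GL (Fin 2) ℤ_[p]) :
    (symK R r k (SymPow.mono R r 0 rfl)).poly =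
      substXY R (k : Matrix (Fin 2) (Fin 2) ℤ_[p]) (X 0) ^ r := by
  rw [symK_poly, SymPow.mono_poly, pow_zero, mul_one, map_pow]

theorem dvd_substXY_linear_pow {τ n : ℕ} (hr : r = b + p ^ τ * (p - 1) * n) (hb : τ ≤ b)
    {M : Matrix (Fin 2) (Fin 2) ℤ_[p]} {D : MvPolynomial (Fin 2) R} (hM : RankOneMod R M D)
    (k : Matrix (Fin 2) (Fin 2) ℤ_[p]) :
    (p : MvPolynomial (Fin 2) R) ^ τ ∣ substXY R M (substXY R k (X 0)) ^ r -
      D ^ (p ^ τ * (p - 1) * n) * substXY R M (substXY R k (X 0)) ^ b := by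
  obtain ⟨u₀, h₀⟩ := hM 0
  obtain ⟨u₁, h₁⟩ := hM 1
  rw [hr]
  refine dvd_pow_sub_mul_pow (u := k 0 0 * u₀ + k 1 0 * u₁) ?_ hb n
  rw [substXY_X R k, map_add, map_mul, map_mul, substXY_algebraMap, substXY_algebraMap]
  have := dvd_add (h₀.mul_left (algebraMap ℤ_[p] _ (k 0 0)))
    (h₁.mul_left (algebraMap ℤ_[p] _ (k 1 0)))
  convert this using 1
  rw [map_add, map_mul, map_mul]
  ring

/-- Under a substitution that has rank one modulo `p`, corresponding forms in degrees `b` and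
`r = b + p ^ τ (p - 1) n` agree modulo `p ^ τ` up to a power of `D`. -/
theorem dvd_substXY_powPair {τ n : ℕ} (hr : r = b + p ^ τ * (p - 1) * n) (hb : τ ≤ b)
    {M : Matrix (Fin 2) (Fin 2) ℤ_[p]} {D : MvPolynomial (Fin 2) R} (hM : RankOneMod R M D)
    {s : SymPow R b} {ψ : SymPow R r} (h : PowPair p s ψ) :
    (p : MvPolynomial (Fin 2) R) ^ τ ∣
      substXY R M ψ.poly - D ^ (p ^ τ * (p - 1) * n) * substXY R M s.poly := by
  induction h with
  | gen k =>
    rw [symK_mono_poly, symK_mono_poly, map_pow, map_pow]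
    exact dvd_substXY_linear_pow hr hb hM k
  | zero =>
    rw [map_zero, map_zero, map_zero, map_zero, mul_zero, sub_zero]
    exact dvd_zero _
  | add _ _ hx hy =>
    rw [map_add, map_add, map_add, map_add, mul_add, add_sub_add_comm]
    exact dvd_add hx hy
  | smul c _ hx =>
    rw [map_smul, map_smul, map_smul, map_smul, mul_smul_comm, ← smul_sub, smul_eq_C_mul]
    exact hx.mul_left _

end PowPairs

/-! ### Sums over Teichmüller representatives -/

section Teichmuller

variable {p : ℕ} [Fact p.Prime]

/-- The Teichmüller character of `𝔽_p`. -/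
def teichHom (p : ℕ) [Fact p.Prime] : ZMod p →* ℤ_[p] :=
  (WittVector.equiv p : WittVector p (ZMod p) →* ℤ_[p]).comp (WittVector.teichmuller p)

theorem teichHom_apply (l : ZMod p) : teichHom p l = teich p l := rfl

theorem teich_zero : teich p 0 = 0 := by
  rw [teich, WittVector.teichmuller_zero, map_zero]

theorem teich_pow_p (l : ZMod p) : teich p l ^ p = teich p l := by
  rw [← teichHom_apply, ← map_pow, ZMod.pow_card]

theorem isUnit_of_toZMod_ne_zero {x : ℤ_[p]} (h : PadicInt.toZMod x ≠ 0) : IsUnit x :=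
  (isUnit_or_dvd p x).resolve_right fun hd => h ((dvd_iff_toZMod p x).1 hd)

theorem isUnit_teich_sub {l m : ZMod p} (h : l ≠ m) : IsUnit (teich p l - teich p m) := by
  refine isUnit_of_toZMod_ne_zero ?_
  rwa [map_sub, toZMod_teich, toZMod_teich, sub_ne_zero]

/-- Orthogonality of the powers of the Teichmüller character. -/
theorem sum_teich_pow {e : ℕ} :
    ∑ l : (ZMod p)ˣ, teich p l ^ e = if p - 1 ∣ e then ((p - 1 : ℕ) : ℤ_[p]) else 0 := by
  classical
  let f : (ZMod p)ˣ →* ℤ_[p] := (powMonoidHom e).comp ((teichHom p).comp (Units.coeHom (ZMod p)))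
  have hf : f = 1 ↔ p - 1 ∣ e := by
    rw [← ZMod.card_units p, ← Nat.card_eq_fintype_card, ← IsCyclic.exponent_eq_card,
      Monoid.exponent_dvd_iff_forall_pow_eq_one]
    refine ⟨fun h u => ?_, fun h => ?_⟩
    · have h1 : teich p (u : ZMod p) ^ e = 1 := DFunLike.congr_fun h u
      have h2 := congrArg PadicInt.toZMod h1
      rw [map_pow, toZMod_teich, map_one] at h2
      exact Units.ext (by simpa using h2)
    · refine MonoidHom.ext fun u => ?_
      change teichHom p (u : ZMod p) ^ e = 1
      rw [← map_pow, ← Units.val_pow_eq_pow_val, h u, Units.val_one, map_one]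
  have := sum_hom_units f
  rw [ZMod.card_units] at this
  change ∑ l : (ZMod p)ˣ, f l = _
  rw [this]
  simp only [hf]
  split_ifs <;> simp

theorem isUnit_natCast_of_not_dvd {k : ℕ} (h : ¬ p ∣ k) : IsUnit (k : ℤ_[p]) := by
  refine isUnit_of_toZMod_ne_zero ?_
  rwa [map_natCast, Ne, ZMod.natCast_eq_zero_iff]

end Teichmuller

/-! ### Powers of linear forms and the defect of a monomial -/

section Monomials

variable {p : ℕ} [Fact p.Prime]

/-- The lower triangular matrix `(1 0; x 1)`. -/
def lowerMat (x : ℤ_[p]) : GL (Fin 2) ℤ_[p] :=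
  ⟨!![1, 0; x, 1], !![1, 0; -x, 1], by simp [Matrix.one_fin_two],
    by simp [Matrix.one_fin_two]⟩

theorem lowerMat_coe (x : ℤ_[p]) :
    (lowerMat x : Matrix (Fin 2) (Fin 2) ℤ_[p]) = !![1, 0; x, 1] := rfl

/-- Representatives of `K` modulo the stabilizer of the point `Y = 0` of `ℙ¹(𝔽_p)`: the matrices
`(1 [l]; 0 1)` and the Weyl element `(0 1; 1 0)`. -/
def kMat (p : ℕ) [Fact p.Prime] : Option (ZMod p) → GL (Fin 2) ℤ_[p]
  | some l => ⟨!![1, teich p l; 0, 1], !![1, -teich p l; 0, 1], by simp [Matrix.one_fin_two],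
      by simp [Matrix.one_fin_two]⟩
  | none => ⟨!![0, 1; 1, 0], !![0, 1; 1, 0], by simp [Matrix.one_fin_two],
      by simp [Matrix.one_fin_two]⟩

theorem kMat_some (l : ZMod p) :
    (kMat p (some l) : Matrix (Fin 2) (Fin 2) ℤ_[p]) = !![1, teich p l; 0, 1] := rfl

theorem kMat_none :
    (kMat p none : Matrix (Fin 2) (Fin 2) ℤ_[p]) = !![0, 1; 1, 0] := rfl

theorem kMat_inv_some (l : ZMod p) :
    (((kMat p (some l))⁻¹ : GL (Fin 2) ℤ_[p]) : Matrix (Fin 2) (Fin 2) ℤ_[p]) =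
      !![1, -teich p l; 0, 1] := rfl

theorem kMat_inv_none :
    (((kMat p none)⁻¹ : GL (Fin 2) ℤ_[p]) : Matrix (Fin 2) (Fin 2) ℤ_[p]) = !![0, 1; 1, 0] := rfl

/-- The matrix `(1 0; 0 p)` over `ℤ_p`. -/
def deltaMat (p : ℕ) [Fact p.Prime] : Matrix (Fin 2) (Fin 2) ℤ_[p] := !![1, 0; 0, (p : ℤ_[p])]

variable (R : Type*) [CommRing R] [Algebra ℤ_[p] R]

theorem sum_teich_smul_pow {b i : ℕ} (hi : 1 ≤ i) (hib : i < b) (hb : b ≤ p - 1) :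
    ∑ l : (ZMod p)ˣ, algebraMap ℤ_[p] (MvPolynomial (Fin 2) R) (teich p l ^ (p - 1 - i)) *
        (algebraMap ℤ_[p] _ (teich p l) * X 1 + X 0) ^ b =
      algebraMap ℤ_[p] _ (((p - 1 : ℕ) : ℤ_[p]) * (b.choose i : ℤ_[p])) *
        (X 0 ^ (b - i) * X 1 ^ i) := by
  have h1 : ∀ l : (ZMod p)ˣ,
      algebraMap ℤ_[p] (MvPolynomial (Fin 2) R) (teich p l ^ (p - 1 - i)) *
        (algebraMap ℤ_[p] _ (teich p l) * X 1 + X 0) ^ b =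
      ∑ j ∈ Finset.range (b + 1), algebraMap ℤ_[p] _ (teich p l ^ (p - 1 - i + j)) *
        (X 1 ^ j * X 0 ^ (b - j) * (b.choose j : MvPolynomial (Fin 2) R)) := fun l => by
    rw [add_pow, Finset.mul_sum]
    refine Finset.sum_congr rfl fun j _ => ?_
    rw [pow_add, map_mul, map_pow (algebraMap ℤ_[p] (MvPolynomial (Fin 2) R)) _ j, mul_pow]
    ring
  rw [Finset.sum_congr rfl fun l _ => h1 l, Finset.sum_comm]
  simp only [← Finset.sum_mul, ← map_sum, sum_teich_pow]
  rw [Finset.sum_eq_single i]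
  · rw [if_pos (by rw [Nat.sub_add_cancel (by omega)]), map_mul, map_natCast, map_natCast]
    ring
  · intro j hj hji
    have hj' := Finset.mem_range.1 hj
    rw [if_neg, map_zero, zero_mul]
    rintro ⟨c, hc⟩
    -- The exponent lies strictly between `0` and `2 (p - 1)`, so it can only be `p - 1`.
    have hc2 : c < 2 := by
      by_contra! h
      have := Nat.mul_le_mul_left (p - 1) h
      omega
    interval_cases c <;> omega
  · intro h
    exact absurd (Finset.mem_range.2 (by omega)) h

variable {R}

theorem SymPow.smul_poly {r : ℕ} (c : R) (w : SymPow R r) : (c • w).poly = C c * w.poly := by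
  rw [map_smul, smul_eq_C_mul]

/-- In degree `b < p` every monomial except `X ^ b` is an explicit combination of `b`-th powers of
linear forms with coefficients in `ℤ_p`. -/
theorem exists_powPair {b r i : ℕ} (hi : 1 ≤ i) (hib : i ≤ b) (hb : b ≤ p - 1) :
    ∃ ψ : SymPow R r, PowPair p (SymPow.mono R (b - i) i (Nat.sub_add_cancel hib)) ψ := by
  rcases hib.eq_or_lt with rfl | hlt
  · have h : SymPow.mono R (i - i) i (Nat.sub_add_cancel hib) =
        symK R i (kMat p none) (SymPow.mono R i 0 rfl) := by
      apply SymPow.ext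
      rw [symK_mono_poly, SymPow.mono_poly, substXY_X, kMat_none]
      simp
    rw [h]
    exact ⟨_, PowPair.gen (kMat p none)⟩
  · have hp1 : 1 < p := (Fact.out : p.Prime).one_lt
    have hu : IsUnit ((((p - 1 : ℕ) : ℤ_[p]) * (b.choose i : ℤ_[p]))) := by
      refine (isUnit_natCast_of_not_dvd ?_).mul (isUnit_natCast_of_not_dvd ?_)
      · exact fun h => absurd (Nat.le_of_dvd (by omega) h) (by omega)
      · intro h
        have h2 : p ∣ b.factorial := by
          rw [← Nat.choose_mul_factorial_mul_factorial hib, mul_assoc]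
          exact h.mul_right _
        have := ((Fact.out : p.Prime).dvd_factorial).1 h2
        omega
    obtain ⟨u, hu⟩ := hu
    have h := (PowPair.sum (p := p) (R := R) (b := b) (r := r) (Finset.univ : Finset (ZMod p)ˣ)
      fun l => (PowPair.gen (lowerMat (teich p l))).smul
        (algebraMap ℤ_[p] R (teich p l ^ (p - 1 - i)))).smul (algebraMap ℤ_[p] R (u⁻¹ : ℤ_[p]ˣ))
    refine ⟨_, h.of_eq (SymPow.ext ?_)⟩
    rw [SymPow.smul_poly, map_sum]
    simp only [SymPow.smul_poly, symK_mono_poly, substXY_X, lowerMat_coe]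
    have := sum_teich_smul_pow (p := p) R hi hlt hb
    rw [← hu] at this
    simp only [← MvPolynomial.algebraMap_apply]
    simp only [Matrix.of_apply, Matrix.cons_val', Matrix.cons_val_zero, Matrix.cons_val_one,
      Matrix.cons_val_fin_one, map_one, one_mul]
    simp only [add_comm (X 0 : MvPolynomial (Fin 2) R)]
    rw [this, ← mul_assoc, ← map_mul, Units.inv_mul, map_one, one_mul, SymPow.mono_poly]

/-- The defect `X ^ (b - i) Y ^ (r - b + i) - ψ`, where `ψ` corresponds to `X ^ (b - i) Y ^ i`, is
divisible by `p ^ τ` after every substitution of rank one modulo `p` that does not send `Y` to zero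
modulo `p`. -/
theorem dvd_substXY_defect {b r i τ n : ℕ} (hr : r = b + p ^ τ * (p - 1) * n) (hbτ : τ ≤ b)
    (hib : i ≤ b) {ψ : SymPow R r}
    (hψ : PowPair p (SymPow.mono R (b - i) i (Nat.sub_add_cancel hib)) ψ)
    {M : Matrix (Fin 2) (Fin 2) ℤ_[p]} (hM : ∀ j, (p : ℤ_[p]) ∣ M 1 j) (hu : IsUnit (M 0 1))
    (h : b - i + (p ^ τ * (p - 1) * n + i) = r) :
    (p : MvPolynomial (Fin 2) R) ^ τ ∣ substXY R M (SymPow.mono R (b - i) _ h - ψ).poly := by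
  have h1 := dvd_substXY_powPair hr hbτ (rankOneMod_zero hM) hψ
  have h2 := (dvd_pow_sub_pow_of_unit hu (dvd_substXY_X_sub (R := R) (hM 1)) τ n).mul_left
    (substXY R M (X 0) ^ (b - i) * substXY R M (X 1) ^ i)
  rw [map_sub, map_sub, SymPow.mono_poly]
  rw [SymPow.mono_poly] at h1
  convert dvd_sub h2 h1 using 1
  simp only [map_mul, map_pow, pow_add]
  ring

/-- Along `(1 0; 0 p)` the defect is `-p ^ i X ^ (r - i) Y ^ i` modulo `p ^ τ`. -/
theorem dvd_substXY_delta_defect {b r i τ n : ℕ} (hr : r = b + p ^ τ * (p - 1) * n) (hbτ : τ ≤ b)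
    (hib : i ≤ b) {ψ : SymPow R r}
    (hψ : PowPair p (SymPow.mono R (b - i) i (Nat.sub_add_cancel hib)) ψ)
    (hm : τ ≤ p ^ τ * (p - 1) * n)
    (h : b - i + (p ^ τ * (p - 1) * n + i) = r) :
    (p : MvPolynomial (Fin 2) R) ^ τ ∣
      substXY R (deltaMat p) (SymPow.mono R (b - i) _ h - ψ).poly +
        (p : MvPolynomial (Fin 2) R) ^ i * (X 0 ^ (r - i) * X 1 ^ i) := by
  have hM : ∀ j, (p : ℤ_[p]) ∣ deltaMat p 1 j := by
    intro j
    fin_cases j <;> simp [deltaMat]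
  have h1 := dvd_substXY_powPair hr hbτ (rankOneMod_zero (R := R) hM) hψ
  have h2 : (p : MvPolynomial (Fin 2) R) ^ τ ∣ substXY R (deltaMat p) (X 1) ^
      (p ^ τ * (p - 1) * n) := by
    refine pow_dvd_pow_of_dvd_of_le ?_ hm
    rw [substXY_X]
    simp [deltaMat]
  have h3 := h2.mul_left (substXY R (deltaMat p) (X 0) ^ (b - i) * substXY R (deltaMat p) (X 1) ^ i)
  have e0 : substXY R (deltaMat p) (X 0) = X 0 := by rw [substXY_X]; simp [deltaMat]
  have e1 : substXY R (deltaMat p) (X 1) = (p : MvPolynomial (Fin 2) R) * X 1 := by rw [substXY_X]; simp [deltaMat]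
  rw [map_sub, map_sub, SymPow.mono_poly]
  rw [SymPow.mono_poly] at h1
  convert dvd_sub h3 h1 using 1
  have e : r - i = p ^ τ * (p - 1) * n + (b - i) := by omega
  simp only [map_mul, map_pow, pow_add, e, e0, e1]
  ring

end Monomials

/-! ### A form concentrated at one point of the projective line -/

section Localized

variable {p : ℕ} [Fact p.Prime] (R : Type*) [CommRing R] [Algebra ℤ_[p] R]

/-- `X ^ q (X ^ (p - 1) - Y ^ (p - 1)) ^ τ`, which vanishes to high order at all points of
`ℙ¹(𝔽_p)` except `Y = 0`. -/
def localForm (p : ℕ) (R : Type*) [CommRing R] {q τ r : ℕ} (h : q + (p - 1) * τ = r) : SymPow R r :=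
  SymPow.ofPoly (X 0 ^ q * (X 0 ^ (p - 1) - X 1 ^ (p - 1)) ^ τ) (by
    rw [← h]
    have := ((isHomogeneous_X R (0 : Fin 2)).pow (p - 1)).sub
      ((isHomogeneous_X R (1 : Fin 2)).pow (p - 1))
    rw [one_mul] at this
    simpa using ((isHomogeneous_X R (0 : Fin 2)).pow q).mul (this.pow τ))

theorem dvd_substXY_localForm_zero {q τ r : ℕ} (h : q + (p - 1) * τ = r) (hτ : τ ≤ p - 1) :
    (p : MvPolynomial (Fin 2) R) ^ τ ∣
      substXY R (adjMat p (some 0)) (localForm p R h).poly - X 0 ^ r := by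
  have e0 : substXY R (adjMat p (some 0)) (X 0) = X 0 := by
    rw [substXY_X]; simp [adjMat, teich_zero]
  have e1 : substXY R (adjMat p (some 0)) (X 1) = (p : MvPolynomial (Fin 2) R) * X 1 := by
    rw [substXY_X]; simp [adjMat, teich_zero]
  rw [localForm, SymPow.ofPoly_poly, map_mul, map_pow, map_pow, map_sub, map_pow, map_pow, e0, e1,
    ← h, pow_add, pow_mul, ← mul_sub]
  refine Dvd.dvd.mul_left (Dvd.dvd.trans ?_ (sub_dvd_pow_sub_pow _ _ τ)) _
  rw [sub_sub_cancel_left, dvd_neg]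
  exact pow_dvd_pow_of_dvd_of_le (dvd_mul_right _ _) hτ

theorem dvd_substXY_localForm {q τ r : ℕ} (h : q + (p - 1) * τ = r) (hq : τ ≤ q)
    {i : Option (ZMod p)} (hi : i ≠ some 0) :
    (p : MvPolynomial (Fin 2) R) ^ τ ∣ substXY R (adjMat p i) (localForm p R h).poly := by
  rw [localForm, SymPow.ofPoly_poly, map_mul, map_pow, map_pow, map_sub, map_pow, map_pow]
  cases i with
  | none =>
    refine Dvd.dvd.mul_right (pow_dvd_pow_of_dvd_of_le ?_ hq) _
    rw [substXY_X]
    simp [adjMat]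
  | some l =>
    refine Dvd.dvd.mul_left (pow_dvd_pow_of_dvd ?_ τ) _
    have hl : IsUnit (-teich p l) := by
      have := isUnit_teich_sub (p := p) (l := 0) (m := l) (by rintro rfl; exact hi rfl)
      rwa [teich_zero, zero_sub] at this
    have e0 : substXY R (adjMat p (some l)) (X 0) = X 0 := by
      rw [substXY_X]; simp [adjMat]
    have h1 := dvd_substXY_X_sub (R := R) (M := adjMat p (some l)) (j := 1) (by simp [adjMat])
    have h2 := dvd_pow_sub_pow_of_unit (u := -teich p l) hl h1 0 1
    have h3 := h1.trans (sub_dvd_pow_sub_pow _ _ (p - 1))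
    have h4 := (dvd_of_dvd_padicInt (A := MvPolynomial (Fin 2) R)
      (dvd_unit_pow_sub_one hl)).mul_right (X 0 ^ (p - 1))
    rw [mul_pow] at h3
    rw [map_sub, map_one, map_pow] at h4
    rw [e0]
    have e : adjMat p (some l) 0 1 = -teich p l := rfl
    rw [e] at h3
    rw [← dvd_neg]
    convert dvd_add h3 h4 using 1
    ring

end Localized

/-! ### Classes in `Π` and the sublattice `𝔪 Θ` -/

section Classes

variable (p : ℕ) [Fact p.Prime] (r : ℕ) (a : PadicAlgCl p)

/-- The class in `Π` of the elementary function `[g, w]` with `w` integral. -/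
def cls (g : GL (Fin 2) ℚ_[p]) : SymPow (ZpBar p) r →ₗ[ZpBar p] PiRep p r a :=
  toPi p r a ∘ₗ cInd.single (KZ p) (symKZ (ZpBar p) r) g

/-- The sublattice `𝔪 Θ` of `Π`, with `𝔪` the maximal ideal of `ℤ̄_p`. -/
def maxTheta : Submodule (ZpBar p) (PiRep p r a) :=
  IsLocalRing.maximalIdeal (ZpBar p) • Theta p r a

variable {p r a}

theorem cls_mem_Theta (g : GL (Fin 2) ℚ_[p]) (w : SymPow (ZpBar p) r) :
    cls p r a g w ∈ Theta p r a := ⟨_, rfl⟩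

theorem norm_p : ‖(p : PadicAlgCl p)‖ = (p : ℝ)⁻¹ := by
  rw [← PadicAlgCl.valuation_coe, PadicAlgCl.valuation_p]; simp

theorem exists_eq_coe {x : PadicAlgCl p} (h : ‖x‖ ≤ 1) :
    ∃ c : ZpBar p, algebraMap (ZpBar p) (PadicAlgCl p) c = x :=
  ⟨⟨x, by
    rw [Valuation.mem_valuationSubring_iff, PadicAlgCl.valuation_def]
    exact_mod_cast h⟩, rfl⟩

theorem mem_maximalIdeal_iff (c : ZpBar p) :
    c ∈ IsLocalRing.maximalIdeal (ZpBar p) ↔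
      ‖algebraMap (ZpBar p) (PadicAlgCl p) c‖ < 1 := by
  have h1 : IsUnit c ↔ ‖algebraMap (ZpBar p) (PadicAlgCl p) c‖ = 1 := by
    refine (Valuation.integer.integers (PadicAlgCl.valued p).v).isUnit_iff_valuation_eq_one.trans ?_
    rw [PadicAlgCl.valuation_def, ← NNReal.coe_eq_one, coe_nnnorm]
    rfl
  have h2 : ‖algebraMap (ZpBar p) (PadicAlgCl p) c‖ ≤ 1 := by
    have := c.2
    rw [Valuation.mem_valuationSubring_iff, PadicAlgCl.valuation_def] at this
    exact_mod_cast this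
  rw [IsLocalRing.mem_maximalIdeal, mem_nonunits_iff, h1, h2.lt_iff_ne]

theorem smul_mem_maxTheta {x : PadicAlgCl p} (hx : ‖x‖ ≤ 1) {y : PiRep p r a}
    (hy : y ∈ maxTheta p r a) : x • y ∈ maxTheta p r a := by
  obtain ⟨c, rfl⟩ := exists_eq_coe hx
  rw [algebraMap_smul]
  exact Submodule.smul_mem _ c hy

theorem smul_cls_mem {x : PadicAlgCl p} (hx : ‖x‖ < 1) (g : GL (Fin 2) ℚ_[p])
    (w : SymPow (ZpBar p) r) : x • cls p r a g w ∈ maxTheta p r a := by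
  obtain ⟨c, rfl⟩ := exists_eq_coe hx.le
  rw [algebraMap_smul]
  exact Submodule.smul_mem_smul ((mem_maximalIdeal_iff c).2 hx) (cls_mem_Theta g w)

theorem smul_cls_mem_of_dvd {x : PadicAlgCl p} {τ : ℕ} (hx : ‖x * p ^ τ‖ < 1)
    (g : GL (Fin 2) ℚ_[p]) {w : SymPow (ZpBar p) r}
    (hw : (p : MvPolynomial (Fin 2) (ZpBar p)) ^ τ ∣ w.poly) :
    x • cls p r a g w ∈ maxTheta p r a := by
  have hw' : C ((p : ZpBar p) ^ τ) ∣ w.poly := by simpa using hw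
  obtain ⟨z, rfl⟩ := SymPow.exists_eq_smul hw'
  rw [map_smul, ← algebraMap_smul (PadicAlgCl p) ((p : ZpBar p) ^ τ), smul_smul]
  refine smul_cls_mem ?_ g z
  rwa [map_pow, map_natCast]

theorem cls_rel (g : GL (Fin 2) ℚ_[p]) (w : SymPow (ZpBar p) r) :
    a • cls p r a g w = ∑ i : Option (ZMod p),
      cls p r a (g * optMat p i) (symAct (ZpBar p) r (adjMat p i) w) := by
  have hc : ∀ g (w : SymPow (ZpBar p) r), cls p r a g w =
      (heckeImage p (PadicAlgCl p) r a).mkQ (cInd.single (KZ p) (symKZ (PadicAlgCl p) r) g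
        (symMap (ZpBar p) (PadicAlgCl p) r w)) := fun g w => by
    change (heckeImage p (PadicAlgCl p) r a).mkQ (indMap (ZpBar p) (PadicAlgCl p) r
      (cInd.single (KZ p) (symKZ (ZpBar p) r) g w)) = _
    rw [indMap_single]
  simp only [hc, symMap_symAct]
  rw [← map_sum, ← heckeFormula_eq, ← map_smul, eq_comm, ← sub_eq_zero, ← map_sub]
  rw [Submodule.mkQ_apply, Submodule.Quotient.mk_eq_zero]
  refine ⟨cInd.single (KZ p) (symKZ (PadicAlgCl p) r) g
        (symMap (ZpBar p) (PadicAlgCl p) r w), ?_⟩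
  rw [LinearMap.sub_apply, LinearMap.smul_apply, LinearMap.id_apply, heckeT,
    cInd.lift_single (KZ p) (symKZ (PadicAlgCl p) r) (N := cInd (KZ p) (symKZ (PadicAlgCl p) r))]

theorem inclK_mem_KZ (k : GL (Fin 2) ℤ_[p]) : inclK p k ∈ KZ p :=
  Subgroup.mem_sup_left ⟨k, rfl⟩

theorem scalar_mem_KZ (z : ℚ_[p]ˣ) : Matrix.GeneralLinearGroup.scalar (Fin 2) z ∈ KZ p := by
  refine Subgroup.mem_sup_right ?_
  rw [Matrix.GeneralLinearGroup.center_eq_range_scalar]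
  exact ⟨z, rfl⟩

theorem cls_mul_inclK (g : GL (Fin 2) ℚ_[p]) (k : GL (Fin 2) ℤ_[p]) (w : SymPow (ZpBar p) r) :
    cls p r a (g * inclK p k) w = cls p r a g (symK (ZpBar p) r k w) := by
  have hk : KZtoK p ⟨inclK p k, inclK_mem_KZ k⟩ = k :=
    KZtoK_unique p _ k 0 (by simp)
  have := cInd.single_mul (KZ p) (symKZ (ZpBar p) r) g ⟨inclK p k, inclK_mem_KZ k⟩ w
  rw [symKZ_apply, hk] at this
  exact congrArg (toPi p r a) this

theorem cls_mul_scalar (g : GL (Fin 2) ℚ_[p]) (w : SymPow (ZpBar p) r) :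
    cls p r a (g * Matrix.GeneralLinearGroup.scalar (Fin 2) (pUnit p)) w = cls p r a g w := by
  have hk : KZtoK p ⟨_, scalar_mem_KZ (pUnit p)⟩ = 1 :=
    KZtoK_unique p _ 1 1 (by simp)
  have := cInd.single_mul (KZ p) (symKZ (ZpBar p) r) g ⟨_, scalar_mem_KZ (pUnit p)⟩ w
  rw [symKZ_apply, hk, Units.val_one, map_one, Module.End.one_apply] at this
  exact congrArg (toPi p r a) this

theorem GL_ext_map {g : GL (Fin 2) ℚ_[p]} {h : GL (Fin 2) ℚ_[p]} {M N : Matrix (Fin 2) (Fin 2) ℤ_[p]}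
    (hg : (g : Matrix (Fin 2) (Fin 2) ℚ_[p]) = M.map (algebraMap ℤ_[p] ℚ_[p]))
    (hh : (h : Matrix (Fin 2) (Fin 2) ℚ_[p]) = N.map (algebraMap ℤ_[p] ℚ_[p])) (e : M = N) :
    g = h := Units.ext (by rw [hg, hh, e])

theorem inclK_coe (k : GL (Fin 2) ℤ_[p]) : (inclK p k : Matrix (Fin 2) (Fin 2) ℚ_[p]) =
    (k : Matrix (Fin 2) (Fin 2) ℤ_[p]).map (algebraMap ℤ_[p] ℚ_[p]) := rfl

theorem gMat_eq (l : ZMod p) : gMat p l = inclK p (kMat p (some l)) * gMat p 0 := by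
  refine GL_ext_map (optMat_coe p (some l))
    (N := (kMat p (some l) : Matrix (Fin 2) (Fin 2) ℤ_[p]) * intMat p (some 0)) ?_ ?_
  · rw [Matrix.map_mul, Units.val_mul, inclK_coe]
    exact congrArg _ (optMat_coe p (some 0))
  · rw [kMat_some]
    simp [intMat, teich_zero]

theorem alphaMat_eq :
    alphaMat p = inclK p (kMat p none) * gMat p 0 * inclK p (kMat p none) := by
  refine GL_ext_map (optMat_coe p none)
    (N := (kMat p none : Matrix (Fin 2) (Fin 2) ℤ_[p]) * intMat p (some 0) * kMat p none) ?_ ?_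
  · rw [Matrix.map_mul, Matrix.map_mul, Units.val_mul, Units.val_mul, inclK_coe]
    exact congrArg (fun M => _ * M * _) (optMat_coe p (some 0))
  · rw [kMat_none]
    simp [intMat, teich_zero]

theorem gMat_mul_alphaMat :
    gMat p 0 * alphaMat p = Matrix.GeneralLinearGroup.scalar (Fin 2) (pUnit p) := by
  refine GL_ext_map (M := intMat p (some 0) * intMat p none)
    (N := !![(p : ℤ_[p]), 0; 0, (p : ℤ_[p])]) ?_ ?_ ?_
  · rw [Matrix.map_mul, Units.val_mul]
    exact congrArg₂ (· * ·) (optMat_coe p (some 0)) (optMat_coe p none)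
  · change Matrix.scalar (Fin 2) (p : ℚ_[p]) = _
    ext i j
    fin_cases i <;> fin_cases j <;> simp [Matrix.natCast_apply]
  · simp [intMat, teich_zero]

/-- The Hecke relation with all `p + 1` terms written as `K`-translates of the one at `Y = 0`. -/
theorem cls_rel' (g : GL (Fin 2) ℚ_[p]) (w : SymPow (ZpBar p) r) :
    a • cls p r a g w = ∑ i : Option (ZMod p), cls p r a (g * inclK p (kMat p i) * gMat p 0)
      (symAct (ZpBar p) r (deltaMat p) (symK (ZpBar p) r (kMat p i)⁻¹ w)) := by
  rw [cls_rel]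
  refine Finset.sum_congr rfl fun i _ => ?_
  change _ = cls p r a _ (symAct (ZpBar p) r (deltaMat p) (symAct (ZpBar p) r
    (((kMat p i)⁻¹ : GL (Fin 2) ℤ_[p]) : Matrix (Fin 2) (Fin 2) ℤ_[p]) w))
  rw [← Module.End.mul_apply, ← map_mul]
  cases i with
  | some l =>
    have h : deltaMat p * (((kMat p (some l))⁻¹ : GL (Fin 2) ℤ_[p]) :
        Matrix (Fin 2) (Fin 2) ℤ_[p]) = adjMat p (some l) := by
      rw [kMat_inv_some]
      simp [deltaMat, adjMat]
    rw [h, mul_assoc, ← gMat_eq]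
    rfl
  | none =>
    have h : deltaMat p * (((kMat p none)⁻¹ : GL (Fin 2) ℤ_[p]) :
        Matrix (Fin 2) (Fin 2) ℤ_[p]) = kMat p none * adjMat p none := by
      rw [kMat_inv_none, kMat_none]
      simp [deltaMat, adjMat]
    change cls p r a (g * alphaMat p) _ = _
    rw [h, alphaMat_eq, ← mul_assoc, ← mul_assoc, cls_mul_inclK, map_mul]
    rfl

end Classes

/-! ### Relations in `Π` modulo `𝔪 Θ` -/

/-- Numerical hypotheses: `τ` is a precision with `2 v(a) - 1 < τ ≤ b` for which `r ≡ b` modulo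
`p ^ τ (p - 1)`, and in the critical case `2 v(a) = b` the number `a ^ 2 / p ^ b` is not congruent
to `1`. Inequalities between valuations are written with norms. -/
structure Admissible (p : ℕ) [Fact p.Prime] (r b τ n : ℕ) (a : PadicAlgCl p) : Prop where
  weight : r = b + p ^ τ * (p - 1) * n
  one_le_n : 1 ≤ n
  prec_le : τ ≤ b
  le_pred : b ≤ p - 1
  ne_zero : a ≠ 0
  norm_lt : ‖a‖ < 1
  lt_sq : ((p : ℝ)⁻¹) ^ (τ + 1) < ‖a‖ ^ 2
  le_sq : ((p : ℝ)⁻¹) ^ b ≤ ‖a‖ ^ 2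
  crit : ((p : ℝ)⁻¹) ^ b = ‖a‖ ^ 2 → τ = b ∧ 1 ≤ ‖a ^ 2 / (p : PadicAlgCl p) ^ b - 1‖

namespace Admissible

variable {p : ℕ} [Fact p.Prime] {r b τ n : ℕ} {a : PadicAlgCl p}

theorem norm_pos (H : Admissible p r b τ n a) : 0 < ‖a‖ := norm_pos_iff.2 H.ne_zero

theorem prec_le_step (H : Admissible p r b τ n a) : (p - 1) * τ ≤ p ^ τ * (p - 1) * n := by
  have h1 : τ ≤ p ^ τ := (Nat.lt_pow_self (Fact.out : p.Prime).one_lt).le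
  calc (p - 1) * τ ≤ (p - 1) * p ^ τ := Nat.mul_le_mul_left _ h1
    _ = p ^ τ * (p - 1) * 1 := by ring
    _ ≤ _ := Nat.mul_le_mul_left _ H.one_le_n

theorem prec_le_mul (H : Admissible p r b τ n a) : τ ≤ p ^ τ * (p - 1) * n := by
  refine le_trans ?_ H.prec_le_step
  have := (Fact.out : p.Prime).two_le
  exact Nat.le_mul_of_pos_left _ (by omega)

theorem inv_p_pos (p : ℕ) [Fact p.Prime] : 0 < (p : ℝ)⁻¹ :=
  inv_pos.2 (by exact_mod_cast (Fact.out : p.Prime).pos)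

theorem inv_p_lt_one (p : ℕ) [Fact p.Prime] : (p : ℝ)⁻¹ < 1 :=
  inv_lt_one_of_one_lt₀ (by exact_mod_cast (Fact.out : p.Prime).one_lt)

theorem inv_p_pow_le {i j : ℕ} (h : i ≤ j) : ((p : ℝ)⁻¹) ^ j ≤ ((p : ℝ)⁻¹) ^ i :=
  pow_le_pow_of_le_one (inv_p_pos p).le (inv_p_lt_one p).le h

theorem sq_lt (H : Admissible p r b τ n a) : ‖a‖ ^ 2 < ‖a‖ := by
  nlinarith [H.norm_pos, H.norm_lt]

theorem norm_step_lt (H : Admissible p r b τ n a) {i : ℕ} (hi : 1 ≤ i) :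
    ‖(p : PadicAlgCl p) ^ i / a ^ 2 * p ^ τ‖ < 1 := by
  rw [norm_mul, norm_div, norm_pow, norm_pow, norm_pow, norm_p, div_mul_eq_mul_div, ← pow_add,
    div_lt_one (pow_pos H.norm_pos 2)]
  exact (inv_p_pow_le (by omega)).trans_lt H.lt_sq

theorem norm_pow_div_mul_prec_lt (H : Admissible p r b τ n a) {i : ℕ} (hi : 1 ≤ i) :
    ‖(p : PadicAlgCl p) ^ i / a * p ^ τ‖ < 1 := by
  rw [norm_mul, norm_div, norm_pow, norm_pow, norm_p, div_mul_eq_mul_div, ← pow_add,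
    div_lt_one H.norm_pos]
  exact (inv_p_pow_le (by omega)).trans_lt (H.lt_sq.trans H.sq_lt)

theorem norm_pow_div_mul_lt (H : Admissible p r b τ n a) {i : ℕ} (hi : 1 ≤ i) :
    ‖(p : PadicAlgCl p) ^ i / a * a‖ < 1 := by
  rw [div_mul_cancel₀ _ H.ne_zero, norm_pow, norm_p]
  exact pow_lt_one₀ (inv_p_pos p).le (inv_p_lt_one p) (by omega)

theorem norm_pow_div_lt (H : Admissible p r b τ n a) {i : ℕ} (hi : b ≤ i) :
    ‖(p : PadicAlgCl p) ^ i / a‖ < 1 := by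
  rw [norm_div, norm_pow, norm_p, div_lt_one H.norm_pos]
  exact (inv_p_pow_le hi).trans_lt (H.le_sq.trans_lt H.sq_lt)

theorem norm_ratio :
    ‖(p : PadicAlgCl p) ^ b / a ^ 2‖ = ((p : ℝ)⁻¹) ^ b / ‖a‖ ^ 2 := by
  rw [norm_div, norm_pow, norm_pow, norm_p]

theorem norm_ratio_le (H : Admissible p r b τ n a) : ‖(p : PadicAlgCl p) ^ b / a ^ 2‖ ≤ 1 := by
  rw [norm_ratio, div_le_one (pow_pos H.norm_pos 2)]
  exact H.le_sq

theorem norm_ratio_mul_lt (H : Admissible p r b τ n a) :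
    ‖(p : PadicAlgCl p) ^ b / a ^ 2 * a‖ < 1 := by
  rw [norm_mul]
  exact (mul_le_of_le_one_left (norm_nonneg a) H.norm_ratio_le).trans_lt H.norm_lt

/-- Either `p ^ b / a ^ 2` lies in the maximal ideal, or it is a unit not congruent to `1` and
`a` divides `p ^ τ` with quotient in the maximal ideal. -/
theorem ratio_cases (H : Admissible p r b τ n a) :
    ‖(p : PadicAlgCl p) ^ b / a ^ 2‖ < 1 ∨
      1 ≤ τ ∧ ‖1 / a * (p : PadicAlgCl p) ^ τ‖ < 1 ∧ 1 ≤ ‖1 - (p : PadicAlgCl p) ^ b / a ^ 2‖ := by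
  rcases H.le_sq.lt_or_eq with h | h
  · left
    rwa [norm_ratio, div_lt_one (pow_pos H.norm_pos 2)]
  · right
    obtain ⟨rfl, h1⟩ := H.crit h
    refine ⟨?_, ?_, ?_⟩
    · by_contra h0
      have h0 : τ = 0 := by omega
      rw [h0, pow_zero] at h
      linarith [H.sq_lt, H.norm_lt]
    · rw [one_div_mul_eq_div]
      exact H.norm_pow_div_lt le_rfl
    · have hp : (p : PadicAlgCl p) ≠ 0 := by
        rw [← norm_pos_iff, norm_p]
        exact inv_p_pos p
      have ha := H.ne_zero
      have e : 1 - (p : PadicAlgCl p) ^ τ / a ^ 2 =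
          ((p : PadicAlgCl p) ^ τ / a ^ 2) * (a ^ 2 / (p : PadicAlgCl p) ^ τ - 1) := by
        field_simp
      rw [e, norm_mul, norm_ratio, h, div_self (pow_pos H.norm_pos 2).ne', one_mul]
      exact h1

theorem norm_ratio_mul_prec_lt (H : Admissible p r b τ n a) :
    ‖(p : PadicAlgCl p) ^ b / a ^ 2 * p ^ τ‖ < 1 := by
  rw [norm_mul, norm_pow, norm_p]
  rcases H.ratio_cases with h | ⟨h, -⟩
  · exact (mul_le_of_le_one_right (norm_nonneg _)
      (pow_le_one₀ (inv_p_pos p).le (inv_p_lt_one p).le)).trans_lt h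
  · exact (mul_le_of_le_one_left (pow_nonneg (inv_p_pos p).le _) H.norm_ratio_le).trans_lt
      (pow_lt_one₀ (inv_p_pos p).le (inv_p_lt_one p) (by omega))

end Admissible

section Relations

variable {p : ℕ} [Fact p.Prime] {r b τ n : ℕ} {a : PadicAlgCl p}

theorem smul_cls_congr {x : PadicAlgCl p} (hx : ‖x * p ^ τ‖ < 1) (g : GL (Fin 2) ℚ_[p])
    {w w' : SymPow (ZpBar p) r}
    (hw : (p : MvPolynomial (Fin 2) (ZpBar p)) ^ τ ∣ w.poly - w'.poly)
    (h : x • cls p r a g w ∈ maxTheta p r a) : x • cls p r a g w' ∈ maxTheta p r a := by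
  have h1 := smul_cls_mem_of_dvd (a := a) hx g (w := w - w') (by rwa [map_sub])
  rw [map_sub, smul_sub] at h1
  simpa using (maxTheta p r a).sub_mem h h1

/-- The class of `X ^ r` is small, because `T` maps a form concentrated at one point of the
projective line to `X ^ r` at a single neighbour. -/
theorem smul_cls_pow_mem (H : Admissible p r b τ n a) {x : PadicAlgCl p} (hxa : ‖x * a‖ < 1)
    (hx : ‖x * p ^ τ‖ < 1) (g : GL (Fin 2) ℚ_[p]) :
    x • cls p r a g (SymPow.mono (ZpBar p) r 0 rfl) ∈ maxTheta p r a := by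
  have hm := H.prec_le_step
  have hr := H.weight
  have hq : r - (p - 1) * τ + (p - 1) * τ = r := by omega
  have hqτ : τ ≤ r - (p - 1) * τ := by have := H.prec_le; omega
  have h1 : (x * a) • cls p r a (g * (gMat p 0)⁻¹) (localForm p (ZpBar p) hq) ∈
      maxTheta p r a := smul_cls_mem hxa _ _
  rw [mul_smul, cls_rel, Finset.smul_sum, ← Finset.add_sum_erase _ _ (Finset.mem_univ (some 0))]
    at h1
  have h2 : ∑ i ∈ Finset.univ.erase (some (0 : ZMod p)), x • cls p r a (g * (gMat p 0)⁻¹ *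
      optMat p i) (symAct (ZpBar p) r (adjMat p i) (localForm p (ZpBar p) hq)) ∈
      maxTheta p r a :=
    Submodule.sum_mem _ fun i hi => smul_cls_mem_of_dvd hx _
      (dvd_substXY_localForm (ZpBar p) hq hqτ (Finset.ne_of_mem_erase hi))
  have h3 := (maxTheta p r a).sub_mem h1 h2
  rw [add_sub_cancel_right] at h3
  have e : g * (gMat p 0)⁻¹ * optMat p (some 0) = g := inv_mul_cancel_right g (gMat p 0)
  rw [e] at h3
  refine smul_cls_congr hx g ?_ h3
  rw [SymPow.mono_poly, pow_zero, mul_one]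
  exact dvd_substXY_localForm_zero (ZpBar p) hq (H.prec_le.trans H.le_pred)

theorem smul_cls_powPair_mem (H : Admissible p r b τ n a) {x : PadicAlgCl p} (hxa : ‖x * a‖ < 1)
    (hx : ‖x * p ^ τ‖ < 1) {s : SymPow (ZpBar p) b} {ψ : SymPow (ZpBar p) r}
    (h : PowPair p s ψ) (g : GL (Fin 2) ℚ_[p]) : x • cls p r a g ψ ∈ maxTheta p r a := by
  induction h with
  | gen k =>
    rw [← cls_mul_inclK]
    exact smul_cls_pow_mem H hxa hx _
  | zero =>
    rw [map_zero, smul_zero]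
    exact Submodule.zero_mem _
  | add _ _ h1 h2 =>
    rw [map_add, smul_add]
    exact Submodule.add_mem _ h1 h2
  | smul c _ h1 =>
    rw [map_smul, smul_comm]
    exact Submodule.smul_mem _ c h1

theorem rankOneMod_adjMat_some {R : Type*} [CommRing R] [Algebra ℤ_[p] R] (l : ZMod p) :
    RankOneMod R (adjMat p (some l)) (X 0) :=
  rankOneMod_zero fun j => by fin_cases j <;> simp [adjMat]

theorem rankOneMod_adjMat_none {R : Type*} [CommRing R] [Algebra ℤ_[p] R] :
    RankOneMod R (adjMat p none) (X 1) :=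
  rankOneMod_one fun j => by fin_cases j <;> simp [adjMat]

/-- The form `X ^ (r - i) Y ^ i - ψ` is annihilated by `T` modulo `p ^ τ` in all directions but
one, where a multiple of `X ^ (b - i) Y ^ (r - b + i)` remains. -/
theorem smul_cls_mono_add_mem (H : Admissible p r b τ n a) {i : ℕ} (hi : 1 ≤ i) (hib : i ≤ b)
    (hir : r - i + i = r) (hbr : b - i + (p ^ τ * (p - 1) * n + i) = r) {ψ : SymPow (ZpBar p) r}
    (hψ : PowPair p (SymPow.mono (ZpBar p) (b - i) i (Nat.sub_add_cancel hib)) ψ)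
    (g : GL (Fin 2) ℚ_[p]) :
    ((p : PadicAlgCl p) ^ i / a) • cls p r a g (SymPow.mono (ZpBar p) (r - i) i hir) +
      ((p : PadicAlgCl p) ^ b / a ^ 2) • cls p r a (g * alphaMat p)
        (SymPow.mono (ZpBar p) (b - i) _ hbr - ψ) ∈ maxTheta p r a := by
  have hr := H.weight
  have hx := H.norm_step_lt hi
  have ha := H.ne_zero
  have hri : r - i = p ^ τ * (p - 1) * n + (b - i) := by omega
  -- The Hecke relation is multiplied by `p ^ i / a ^ 2`, which makes errors divisible by `p ^ τ`
  -- negligible because `2 v(a) < i + τ`.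
  have h1 := cls_rel (a := a) g (SymPow.mono (ZpBar p) (r - i) i hir - ψ)
  rw [Fintype.sum_option] at h1
  replace h1 := congrArg (fun y => ((p : PadicAlgCl p) ^ i / a ^ 2) • y) h1
  simp only [smul_add, smul_smul, Finset.smul_sum] at h1
  have hsome : ∑ l : ZMod p, ((p : PadicAlgCl p) ^ i / a ^ 2) • cls p r a (g * optMat p (some l))
      (symAct (ZpBar p) r (adjMat p (some l)) (SymPow.mono (ZpBar p) (r - i) i hir - ψ)) ∈
      maxTheta p r a := by
    refine Submodule.sum_mem _ fun l _ => smul_cls_mem_of_dvd hx _ ?_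
    have h2 := dvd_substXY_powPair hr H.prec_le (rankOneMod_adjMat_some l) hψ
    have e0 : substXY (ZpBar p) (adjMat p (some l)) (X 0) = X 0 := by
      rw [substXY_X]; simp [adjMat]
    rw [symAct_poly, map_sub, map_sub, SymPow.mono_poly, ← dvd_neg, neg_sub]
    rw [SymPow.mono_poly] at h2
    convert h2 using 2
    rw [map_mul, map_mul, map_pow, map_pow, map_pow, e0, hri, pow_add, mul_assoc]
  have hnone : ((p : PadicAlgCl p) ^ i / a ^ 2) • cls p r a (g * optMat p none)
      (symAct (ZpBar p) r (adjMat p none) (SymPow.mono (ZpBar p) (r - i) i hir - ψ) +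
        (p : ZpBar p) ^ (b - i) • SymPow.mono (ZpBar p) (b - i) _ hbr) ∈ maxTheta p r a := by
    refine smul_cls_mem_of_dvd hx _ ?_
    have h2 := dvd_substXY_powPair hr H.prec_le rankOneMod_adjMat_none hψ
    have e0 : substXY (ZpBar p) (adjMat p none) (X 0) =
        (p : MvPolynomial (Fin 2) (ZpBar p)) * X 0 := by
      rw [substXY_X]; simp [adjMat]
    have e1 : substXY (ZpBar p) (adjMat p none) (X 1) = X 1 := by
      rw [substXY_X]; simp [adjMat]
    have h3 : (p : MvPolynomial (Fin 2) (ZpBar p)) ^ τ ∣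
        ((p : MvPolynomial (Fin 2) (ZpBar p)) * X 0) ^ (r - i) * X 1 ^ i :=
      (pow_dvd_pow_of_dvd_of_le (dvd_mul_right _ _)
        (by have := H.prec_le_mul; omega)).mul_right _
    rw [map_add, SymPow.smul_poly, symAct_poly, map_sub, map_sub, SymPow.mono_poly,
      SymPow.mono_poly, map_pow C, map_natCast C]
    rw [SymPow.mono_poly] at h2
    convert dvd_sub h3 h2 using 1
    simp only [map_mul, map_pow, e0, e1, mul_pow, pow_add]
    ring
  have hψg := smul_cls_powPair_mem H (H.norm_pow_div_mul_lt hi) (H.norm_pow_div_mul_prec_lt hi) hψ g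
  have hψα := smul_cls_powPair_mem H H.norm_ratio_mul_lt H.norm_ratio_mul_prec_lt hψ
    (g * alphaMat p)
  have ec : ((p : PadicAlgCl p) ^ i / a ^ 2) * (p : PadicAlgCl p) ^ (b - i) =
      (p : PadicAlgCl p) ^ b / a ^ 2 := by
    rw [div_mul_eq_mul_div, ← pow_add, Nat.add_sub_cancel' hib]
  have ex : (p : PadicAlgCl p) ^ i / a ^ 2 * a = (p : PadicAlgCl p) ^ i / a := by
    field_simp
  rw [map_add, map_smul, ← algebraMap_smul (PadicAlgCl p) ((p : ZpBar p) ^ (b - i)), map_pow,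
    map_natCast, smul_add, smul_smul, ec] at hnone
  rw [ex, map_sub, smul_sub] at h1
  have h4 := (maxTheta p r a).sub_mem ((maxTheta p r a).add_mem
    ((maxTheta p r a).add_mem hnone hsome) hψg) hψα
  rw [map_sub, smul_sub]
  convert h4 using 1
  change _ = _ + ((p : PadicAlgCl p) ^ b / a ^ 2) • cls p r a (g * alphaMat p) _ + _ + _ - _
  rw [sub_eq_iff_eq_add] at h1
  rw [h1]
  abel

/-- For every `i ≥ 1` there is a form `U` that is concentrated at the point `Y = 0`, where it
looks like `-X ^ (b - i) Y ^ i`, and whose translate cancels `(p ^ i / a) X ^ (r - i) Y ^ i` up to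
the factor `-p ^ b / a ^ 2`. -/
theorem exists_defect (H : Admissible p r b τ n a) {i : ℕ} (hi : 1 ≤ i) (hir : r - i + i = r) :
    ∃ U : SymPow (ZpBar p) r,
      (∀ g, ((p : PadicAlgCl p) ^ i / a) • cls p r a g (SymPow.mono (ZpBar p) (r - i) i hir) +
        ((p : PadicAlgCl p) ^ b / a ^ 2) • cls p r a (g * alphaMat p) U ∈ maxTheta p r a) ∧
      (∀ M : Matrix (Fin 2) (Fin 2) ℤ_[p], (∀ j, (p : ℤ_[p]) ∣ M 1 j) → IsUnit (M 0 1) →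
        (p : MvPolynomial (Fin 2) (ZpBar p)) ^ τ ∣ substXY (ZpBar p) M U.poly) ∧
      (p : MvPolynomial (Fin 2) (ZpBar p)) ^ τ ∣ substXY (ZpBar p) (deltaMat p) U.poly +
        (p : MvPolynomial (Fin 2) (ZpBar p)) ^ i * (X 0 ^ (r - i) * X 1 ^ i) := by
  rcases le_or_gt i b with hib | hib
  · have hr := H.weight
    have hbr : b - i + (p ^ τ * (p - 1) * n + i) = r := by omega
    obtain ⟨ψ, hψ⟩ := exists_powPair (p := p) (R := ZpBar p) (r := r) hi hib H.le_pred
    exact ⟨SymPow.mono (ZpBar p) (b - i) _ hbr - ψ, smul_cls_mono_add_mem H hi hib hir hbr hψ,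
      fun M hM hu => dvd_substXY_defect hr H.prec_le hib hψ hM hu hbr,
      dvd_substXY_delta_defect hr H.prec_le hib hψ H.prec_le_mul hbr⟩
  · refine ⟨0, fun g => ?_, fun M _ _ => ?_, ?_⟩
    · rw [map_zero, smul_zero, add_zero]
      exact smul_cls_mem (H.norm_pow_div_lt hib.le) _ _
    · rw [map_zero, map_zero]
      exact dvd_zero _
    · rw [map_zero, map_zero, zero_add]
      exact (pow_dvd_pow _ (H.prec_le.trans hib.le)).mul_right _

end Relations

/-! ### Forms vanishing on the projective line over `𝔽_p` -/

namespace SymPow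

variable {R : Type*} [CommRing R] {r : ℕ}

theorem sub_add_of_fin (i : Fin (r + 1)) : r - i.1 + i.1 = r :=
  Nat.sub_add_cancel (Nat.lt_succ_iff.1 i.2)

/-- The linear map `X ^ (r - i) Y ^ i ↦ U i`. -/
def extend (U : Fin (r + 1) → SymPow R r) (w : SymPow R r) : SymPow R r :=
  ∑ i : Fin (r + 1), w.coef i.1 • U i

theorem coef_eq_zero_of_eq {w : SymPow R r} (h0 : w.coef 0 = 0) {i : ℕ} (h : i = 0) :
    w.coef i = 0 := by
  rw [h, h0]

theorem extend_poly (U : Fin (r + 1) → SymPow R r) (w : SymPow R r) :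
    (extend U w).poly = ∑ i : Fin (r + 1), C (w.coef i) * (U i).poly := by
  simp only [extend, map_sum, smul_poly]

theorem poly_eq_sum_fin (w : SymPow R r) :
    w.poly = ∑ i : Fin (r + 1), C (w.coef i) * (X 0 ^ (r - i.1) * X 1 ^ i.1) := by
  rw [poly_eq_sum, Finset.sum_range]

variable {p : ℕ} [Fact p.Prime] [Algebra ℤ_[p] R]

theorem substXY_deltaMat_eq_sum (w : SymPow R r) :
    substXY R (deltaMat p) w.poly = ∑ i : Fin (r + 1), C (w.coef i) *
      ((p : MvPolynomial (Fin 2) R) ^ i.1 * (X 0 ^ (r - i.1) * X 1 ^ i.1)) := by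
  have e0 : substXY R (deltaMat p) (X 0) = X 0 := by rw [substXY_X]; simp [deltaMat]
  have e1 : substXY R (deltaMat p) (X 1) = (p : MvPolynomial (Fin 2) R) * X 1 := by
    rw [substXY_X]; simp [deltaMat]
  conv_lhs => rw [poly_eq_sum_fin w]
  rw [map_sum]
  refine Finset.sum_congr rfl fun i _ => ?_
  have eC : ∀ c : R, substXY R (deltaMat p) (C c) = C c := fun c =>
    (substXY R (deltaMat p)).commutes c
  rw [map_mul, map_mul, map_pow, map_pow, e0, e1, eC, mul_pow]
  ring

theorem symAct_deltaMat_eq_sum (w : SymPow R r) :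
    symAct R r (deltaMat p) w = ∑ i : Fin (r + 1), w.coef i •
      (p : R) ^ i.1 • mono R (r - i.1) i.1 (sub_add_of_fin i) := by
  apply SymPow.ext
  rw [symAct_poly, substXY_deltaMat_eq_sum, map_sum]
  refine Finset.sum_congr rfl fun i _ => ?_
  rw [smul_poly, smul_poly, mono_poly, map_pow, map_natCast]

end SymPow

section Main

variable {p : ℕ} [Fact p.Prime] {r b τ n : ℕ} {a : PadicAlgCl p}

theorem dvd_deltaMat_mul (M : Matrix (Fin 2) (Fin 2) ℤ_[p]) (j : Fin 2) :
    (p : ℤ_[p]) ∣ (deltaMat p * M) 1 j := by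
  rw [Matrix.mul_apply, Fin.sum_univ_two]
  simp [deltaMat]

/-- For `i ≠ j` the matrix `δ k_j⁻¹ k_i`, which has rank one modulo `p`, does not send `Y` to
zero modulo `p`. -/
theorem isUnit_deltaMat_mul {i j : Option (ZMod p)} (h : i ≠ j) :
    IsUnit ((deltaMat p * ((((kMat p j)⁻¹ * kMat p i : GL (Fin 2) ℤ_[p])) :
      Matrix (Fin 2) (Fin 2) ℤ_[p])) 0 1) := by
  rw [Units.val_mul, Matrix.mul_apply, Fin.sum_univ_two, Matrix.mul_apply, Fin.sum_univ_two]
  cases i with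
  | none =>
    cases j with
    | none => exact absurd rfl h
    | some l => rw [kMat_inv_some, kMat_none]; simp [deltaMat]
  | some m =>
    cases j with
    | none => rw [kMat_inv_none, kMat_some]; simp [deltaMat]
    | some l =>
      rw [kMat_inv_some, kMat_some]
      have := isUnit_teich_sub (p := p) (l := m) (m := l) (fun e => h (by rw [e]))
      simpa [deltaMat, sub_eq_add_neg] using this

/-- An integral form vanishing at all points of `ℙ¹(𝔽_p)`, in the sense that `Y` divides all its
translates by `k_i⁻¹`, has class in `𝔪 Θ`. -/
theorem cls_mem_maxTheta (H : Admissible p r b τ n a) (w : SymPow (ZpBar p) r)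
    (hw : ∀ i, (X 1 : MvPolynomial (Fin 2) (ZpBar p)) ∣
      (symK (ZpBar p) r (kMat p i)⁻¹ w).poly)
    (g : GL (Fin 2) ℚ_[p]) : cls p r a g w ∈ maxTheta p r a := by
  have ha := H.ne_zero
  have hU : ∀ i : Fin (r + 1), ∃ U : SymPow (ZpBar p) r, 1 ≤ i.1 →
      (∀ g, ((p : PadicAlgCl p) ^ i.1 / a) • cls p r a g
          (SymPow.mono (ZpBar p) (r - i.1) i.1 (SymPow.sub_add_of_fin i)) +
        ((p : PadicAlgCl p) ^ b / a ^ 2) • cls p r a (g * alphaMat p) U ∈ maxTheta p r a) ∧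
      (∀ M : Matrix (Fin 2) (Fin 2) ℤ_[p], (∀ j, (p : ℤ_[p]) ∣ M 1 j) → IsUnit (M 0 1) →
        (p : MvPolynomial (Fin 2) (ZpBar p)) ^ τ ∣ substXY (ZpBar p) M U.poly) ∧
      (p : MvPolynomial (Fin 2) (ZpBar p)) ^ τ ∣ substXY (ZpBar p) (deltaMat p) U.poly +
        (p : MvPolynomial (Fin 2) (ZpBar p)) ^ i.1 * (X 0 ^ (r - i.1) * X 1 ^ i.1) := fun i => by
    rcases Nat.eq_zero_or_pos i.1 with h | h
    · exact ⟨0, fun h1 => absurd h1 (by omega)⟩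
    · obtain ⟨U, hU⟩ := exists_defect H h (SymPow.sub_add_of_fin i)
      exact ⟨U, fun _ => hU⟩
  choose U hU using hU
  set c : PadicAlgCl p := (p : PadicAlgCl p) ^ b / a ^ 2 with hc
  -- One neighbour: the part of `T [g, w]` there is moved back to the original vertex.
  have hstep : ∀ (W : SymPow (ZpBar p) r), W.coef 0 = 0 → ∀ g,
      (1 / a) • cls p r a g (symAct (ZpBar p) r (deltaMat p) W) +
        c • cls p r a (g * alphaMat p) (SymPow.extend U W) ∈ maxTheta p r a := by
    intro W hW g
    rw [SymPow.symAct_deltaMat_eq_sum, SymPow.extend, map_sum, map_sum, Finset.smul_sum,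
      Finset.smul_sum, ← Finset.sum_add_distrib]
    refine Submodule.sum_mem _ fun i _ => ?_
    rw [map_smul, map_smul, map_smul, smul_comm _ (W.coef i), smul_comm _ (W.coef i), ← smul_add]
    rcases Nat.eq_zero_or_pos i.1 with h | h
    · rw [SymPow.coef_eq_zero_of_eq hW h, zero_smul]
      exact Submodule.zero_mem _
    · refine Submodule.smul_mem _ _ ?_
      have := (hU i h).1 g
      rw [← algebraMap_smul (PadicAlgCl p) ((p : ZpBar p) ^ i.1), map_pow, map_natCast, smul_smul,
        one_div_mul_eq_div]
      exact this
  have hcoef : ∀ i, (symK (ZpBar p) r (kMat p i)⁻¹ w).coef 0 = 0 := fun i =>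
    SymPow.coef_zero_eq_zero (hw i)
  set S : SymPow (ZpBar p) r := ∑ i : Option (ZMod p), symK (ZpBar p) r (kMat p i)
    (SymPow.extend U (symK (ZpBar p) r (kMat p i)⁻¹ w)) with hS
  have h1 : cls p r a g w + c • cls p r a g S ∈ maxTheta p r a := by
    have h2 : cls p r a g w = (1 / a) • (a • cls p r a g w) := by
      rw [smul_smul, one_div_mul_cancel ha, one_smul]
    rw [h2, cls_rel', hS, map_sum, Finset.smul_sum, Finset.smul_sum, ← Finset.sum_add_distrib]
    refine Submodule.sum_mem _ fun i _ => ?_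
    have h3 := hstep _ (hcoef i) (g * inclK p (kMat p i) * gMat p 0)
    rwa [mul_assoc _ (gMat p 0), gMat_mul_alphaMat, cls_mul_scalar, cls_mul_inclK] at h3
  rcases H.ratio_cases with hlt | ⟨-, hτ, hunit⟩
  · have h2 := (maxTheta p r a).sub_mem h1 (smul_cls_mem hlt g S)
    rwa [add_sub_cancel_right] at h2
  · -- In the critical case `S` is `-w` up to a form annihilated by `T` modulo `p ^ τ`.
    have hu : cls p r a g (w + S) ∈ maxTheta p r a := by
      have h2 : cls p r a g (w + S) = (1 / a) • (a • cls p r a g (w + S)) := by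
        rw [smul_smul, one_div_mul_cancel ha, one_smul]
      rw [h2, cls_rel', Finset.smul_sum]
      refine Submodule.sum_mem _ fun j _ => smul_cls_mem_of_dvd hτ _ ?_
      rw [symAct_poly, map_add, map_add, map_add, hS, map_sum, map_sum, map_sum,
        ← Finset.add_sum_erase _ _ (Finset.mem_univ j), ← add_assoc]
      refine dvd_add ?_ (Finset.dvd_sum fun i hi => ?_)
      · rw [← Module.End.mul_apply, ← map_mul, inv_mul_cancel, map_one, Module.End.one_apply,
          SymPow.substXY_deltaMat_eq_sum, SymPow.extend_poly, map_sum, ← Finset.sum_add_distrib]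
        refine Finset.dvd_sum fun i _ => ?_
        rw [map_mul, show substXY (ZpBar p) (deltaMat p) (C _) = C _ from
          (substXY (ZpBar p) (deltaMat p)).commutes _, ← mul_add,
          add_comm ((p : MvPolynomial (Fin 2) (ZpBar p)) ^ i.1 * _)]
        rcases Nat.eq_zero_or_pos i.1 with h | h
        · rw [SymPow.coef_eq_zero_of_eq (hcoef j) h, map_zero, zero_mul]
          exact dvd_zero _
        · exact (hU i h).2.2.mul_left _
      · rw [← Module.End.mul_apply, ← map_mul, symK_poly, ← substXY_mul, SymPow.extend_poly,
          map_sum]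
        refine Finset.dvd_sum fun l _ => ?_
        rw [map_mul, show ∀ M x, substXY (ZpBar p) M (C x) = C x from fun M x =>
          (substXY (ZpBar p) M).commutes x]
        rcases Nat.eq_zero_or_pos l.1 with h | h
        · rw [SymPow.coef_eq_zero_of_eq (hcoef i) h, map_zero, zero_mul]
          exact dvd_zero _
        · exact ((hU l h).2.1 _ (dvd_deltaMat_mul _)
            (isUnit_deltaMat_mul (Finset.ne_of_mem_erase hi))).mul_left _
    have h2 := (maxTheta p r a).sub_mem h1 (smul_mem_maxTheta H.norm_ratio_le hu)
    have h3 : (1 - c) • cls p r a g w ∈ maxTheta p r a := by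
      convert h2 using 1
      rw [map_add, smul_add, sub_smul, one_smul]
      abel
    have hne : (1 - c) ≠ 0 := by
      rw [← norm_pos_iff]
      linarith
    have h4 := smul_mem_maxTheta (x := (1 - c)⁻¹) (by
      rw [norm_inv]
      exact inv_le_one_of_one_le₀ hunit) h3
    rwa [smul_smul, inv_mul_cancel₀ hne, one_smul] at h4

end Main

/-! ### Forms divisible by `θ` modulo `𝔪` -/

section ThetaDivisible

variable {p : ℕ} [Fact p.Prime] {r b τ n : ℕ} {a : PadicAlgCl p}

/-- Forms with vanishing reduction have class in `𝔪 Θ`. -/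
theorem cls_mem_of_symMap_eq_zero {w : SymPow (ZpBar p) r}
    (hw : symMap (ZpBar p) (FpBar p) r w = 0) (g : GL (Fin 2) ℚ_[p]) :
    cls p r a g w ∈ maxTheta p r a := by
  have hcoef : ∀ i, w.coef i ∈ IsLocalRing.maximalIdeal (ZpBar p) := fun i => by
    have h1 : MvPolynomial.map (algebraMap (ZpBar p) (FpBar p)) w.poly = 0 :=
      congrArg SymPow.poly hw
    have h2 := congrArg (coeff (Finsupp.single 0 (r - i) + Finsupp.single 1 i)) h1
    rw [coeff_map, coeff_zero] at h2
    exact (IsLocalRing.residue_eq_zero_iff _).1 h2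
  have hw' : w = ∑ i : Fin (r + 1), w.coef i.1 •
      SymPow.mono (ZpBar p) (r - i.1) i.1 (SymPow.sub_add_of_fin i) := by
    apply SymPow.ext
    rw [map_sum, SymPow.poly_eq_sum_fin]
    exact Finset.sum_congr rfl fun i _ => by rw [SymPow.smul_poly, SymPow.mono_poly]
  rw [hw', map_sum]
  refine Submodule.sum_mem _ fun i _ => ?_
  rw [map_smul]
  exact Submodule.smul_mem_smul (hcoef i) (cls_mem_Theta g _)

/-- The polynomial `θ = X ^ p Y - Y ^ p X` over an arbitrary ring. -/
def thetaLift (p : ℕ) (R : Type*) [CommRing R] : MvPolynomial (Fin 2) R :=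
  X 0 ^ p * X 1 - X 1 ^ p * X 0

theorem thetaLift_isHomogeneous {p : ℕ} (R : Type*) [CommRing R] :
    (thetaLift p R).IsHomogeneous (p + 1) := by
  have h0 : ∀ i j : Fin 2, (X i ^ p * X j : MvPolynomial (Fin 2) R).IsHomogeneous (p + 1) :=
    fun i j => by
      have := ((isHomogeneous_X R i).pow p).mul (isHomogeneous_X R j)
      rwa [one_mul] at this
  exact (h0 0 1).sub (h0 1 0)

/-- `θ` vanishes at all Teichmüller points of the projective line; for the sign of the
Teichmüller representatives `p` has to be odd. -/
theorem dvd_substXY_thetaLift {R : Type*} [CommRing R] [Algebra ℤ_[p] R] (hp2 : p ≠ 2)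
    (i : Option (ZMod p)) : (X 1 : MvPolynomial (Fin 2) R) ∣ substXY R
      (((kMat p i)⁻¹ : GL (Fin 2) ℤ_[p]) : Matrix (Fin 2) (Fin 2) ℤ_[p]) (thetaLift p R) := by
  rw [thetaLift, map_sub, map_mul, map_mul, map_pow, map_pow]
  have hp0 : p ≠ 0 := (Fact.out : p.Prime).ne_zero
  cases i with
  | none =>
    rw [substXY_X, substXY_X, kMat_inv_none]
    simpa using dvd_sub ((dvd_pow_self (X 1 : MvPolynomial (Fin 2) R) hp0).mul_right (X 0))
      (dvd_mul_left (X 1) (X 0 ^ p))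
  | some l =>
    have hodd : Odd p := (Fact.out : p.Prime).odd_of_ne_two hp2
    set t : MvPolynomial (Fin 2) R := algebraMap ℤ_[p] _ (teich p l) with ht
    have htp : t ^ p = t := by rw [ht, ← map_pow, teich_pow_p]
    have e0 : substXY R (((kMat p (some l))⁻¹ : GL (Fin 2) ℤ_[p]) :
        Matrix (Fin 2) (Fin 2) ℤ_[p]) (X 0) = X 0 := by
      rw [substXY_X, kMat_inv_some]; simp
    have e1 : substXY R (((kMat p (some l))⁻¹ : GL (Fin 2) ℤ_[p]) :
        Matrix (Fin 2) (Fin 2) ℤ_[p]) (X 1) = -(t * X 0) + X 1 := by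
      rw [substXY_X, kMat_inv_some]; simp [ht]
    have h1 := (sub_dvd_pow_sub_pow (-(t * X 0) + X 1) (-(t * X 0)) p).mul_right (X 0)
    rw [add_sub_cancel_left, hodd.neg_pow, mul_pow, htp] at h1
    rw [e0, e1]
    convert dvd_sub (dvd_mul_left (X 1) (X 0 ^ p)) h1 using 1
    ring

theorem homogeneous_mul_cases {R : Type*} [CommRing R] {f q : MvPolynomial (Fin 2) R} {m k : ℕ}
    (hf : f.IsHomogeneous m) (h : (f * q).IsHomogeneous k) :
    f * q = 0 ∨ ∃ j, m + j = k ∧ f * q = f * homogeneousComponent j q := by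
  let := gradedAlgebra (σ := Fin 2) (R := R)
  have h1 : ∀ (φ : MvPolynomial (Fin 2) R) (i : ℕ), (DirectSum.decompose
      (homogeneousSubmodule (Fin 2) R) φ i : MvPolynomial (Fin 2) R) = homogeneousComponent i φ :=
    fun φ i => decomposition.decompose'_apply φ i
  have h2 : homogeneousComponent k (f * q) = f * q := homogeneousComponent_eq_self h
  have hf' : f ∈ homogeneousSubmodule (Fin 2) R m := hf
  by_cases hm : m ≤ k
  · right
    refine ⟨k - m, by omega, ?_⟩
    conv_lhs => rw [← h2, ← h1, DirectSum.coe_decompose_mul_of_left_mem_of_le _ hf' hm, h1]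
  · left
    rw [← h2, ← h1, DirectSum.coe_decompose_mul_of_left_mem_of_not_le _ hf' hm]

theorem symMap_surjective (p : ℕ) [Fact p.Prime] (r : ℕ) :
    Function.Surjective (symMap (ZpBar p) (FpBar p) r) := by
  intro v
  obtain ⟨f, hf⟩ := MvPolynomial.map_surjective (σ := Fin 2) (algebraMap (ZpBar p) (FpBar p))
    (IsLocalRing.residue_surjective (R := ZpBar p)) v.poly
  refine ⟨SymPow.ofPoly _ (homogeneousComponent_isHomogeneous r f), SymPow.ext ?_⟩
  change MvPolynomial.map (algebraMap (ZpBar p) (FpBar p)) (homogeneousComponent r f) = v.poly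
  rw [← homogeneousComponent_eq_self (SymPow.isHomogeneous_poly v), ← hf]
  ext d
  rw [coeff_map, coeff_homogeneousComponent, coeff_homogeneousComponent, coeff_map]
  split_ifs
  · rfl
  · exact map_zero _

/-- A form whose reduction is divisible by `θ` is, up to a form with vanishing reduction, itself
divisible by `θ`. -/
theorem exists_dvd_of_symMap_mem {w : SymPow (ZpBar p) r}
    (hw : symMap (ZpBar p) (FpBar p) r w ∈ thetaSub p (FpBar p) r 1) :
    symMap (ZpBar p) (FpBar p) r w = 0 ∨ p + 1 ≤ r ∧ ∃ w' : SymPow (ZpBar p) r,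
      thetaLift p (ZpBar p) ∣ w'.poly ∧ symMap (ZpBar p) (FpBar p) r (w - w') = 0 := by
  obtain ⟨q, hq⟩ := hw
  rw [pow_one] at hq
  have hθ : thetaPoly p (FpBar p) = thetaLift p (FpBar p) := rfl
  have hhom := SymPow.isHomogeneous_poly (symMap (ZpBar p) (FpBar p) r w)
  rw [hq, hθ] at hhom
  rcases homogeneous_mul_cases (thetaLift_isHomogeneous (FpBar p)) hhom with h0 | ⟨j, hj, h1⟩
  · left
    apply SymPow.ext
    rw [hq, hθ, h0, map_zero]
  · right
    refine ⟨by omega, ?_⟩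
    obtain ⟨v, hv⟩ := symMap_surjective p j
      (SymPow.ofPoly _ (homogeneousComponent_isHomogeneous j q))
    have hv' : MvPolynomial.map (algebraMap (ZpBar p) (FpBar p)) v.poly =
        homogeneousComponent j q := congrArg SymPow.poly hv
    refine ⟨SymPow.ofPoly (thetaLift p (ZpBar p) * v.poly) (hj ▸
      (thetaLift_isHomogeneous (ZpBar p)).mul (SymPow.isHomogeneous_poly v)), dvd_mul_right _ _, ?_⟩
    rw [map_sub, sub_eq_zero]
    apply SymPow.ext
    rw [hq, hθ, h1, ← hv']
    change _ = MvPolynomial.map (algebraMap (ZpBar p) (FpBar p)) (thetaLift p (ZpBar p) * v.poly)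
    rw [map_mul]
    simp [thetaLift]

theorem cls_mem_of_symMap_mem (hp2 : p ≠ 2) (hA : p + 1 ≤ r → ∃ b τ n, Admissible p r b τ n a)
    {w : SymPow (ZpBar p) r} (hw : symMap (ZpBar p) (FpBar p) r w ∈ thetaSub p (FpBar p) r 1)
    (g : GL (Fin 2) ℚ_[p]) : cls p r a g w ∈ maxTheta p r a := by
  rcases exists_dvd_of_symMap_mem hw with h0 | ⟨hr, w', ⟨q, hq⟩, h0⟩
  · exact cls_mem_of_symMap_eq_zero h0 g
  · obtain ⟨b, τ, n, H⟩ := hA hr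
    have h1 := cls_mem_maxTheta H w' (fun i => by
      rw [symK_poly, hq, map_mul]
      exact (dvd_substXY_thetaLift hp2 i).mul_right _) g
    have h2 := cls_mem_of_symMap_eq_zero (a := a) h0 g
    rw [map_sub] at h2
    simpa using (maxTheta p r a).add_mem h2 h1

end ThetaDivisible

/-! ### The surjection onto `Θ̄` -/

section Surjection

variable {p : ℕ} [Fact p.Prime] {r : ℕ} {a : PadicAlgCl p}

theorem one_tmul_eq_zero {x : Theta p r a} (hx : (x : PiRep p r a) ∈ maxTheta p r a) :
    (1 : FpBar p) ⊗ₜ[ZpBar p] x = 0 := by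
  have key : ∀ y ∈ maxTheta p r a, ∃ h : y ∈ Theta p r a,
      (1 : FpBar p) ⊗ₜ[ZpBar p] (⟨y, h⟩ : Theta p r a) = 0 := by
    intro y hy
    refine Submodule.smul_induction_on hy (fun m hm y hy => ?_) (fun y z => ?_)
    · refine ⟨Submodule.smul_mem _ m hy, ?_⟩
      change (1 : FpBar p) ⊗ₜ[ZpBar p] (m • (⟨y, hy⟩ : Theta p r a)) = 0
      have : m • (1 : FpBar p) = 0 := by
        rw [Algebra.smul_def, mul_one]
        exact (IsLocalRing.residue_eq_zero_iff m).2 hm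
      rw [← TensorProduct.smul_tmul, this, TensorProduct.zero_tmul]
    · rintro ⟨hy, hy0⟩ ⟨hz, hz0⟩
      refine ⟨Submodule.add_mem _ hy hz, ?_⟩
      change (1 : FpBar p) ⊗ₜ[ZpBar p] ((⟨y, hy⟩ : Theta p r a) + ⟨z, hz⟩) = 0
      rw [TensorProduct.tmul_add, hy0, hz0, add_zero]
  obtain ⟨_, h⟩ := key x hx
  exact h

/-- The class of `[g, w]` in `Θ̄`. -/
def clsBar (p : ℕ) [Fact p.Prime] (r : ℕ) (a : PadicAlgCl p) (g : GL (Fin 2) ℚ_[p]) :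
    SymPow (ZpBar p) r →ₗ[ZpBar p] ThetaBar p r a :=
  TensorProduct.mk (ZpBar p) (FpBar p) (Theta p r a) 1 ∘ₗ toTheta p r a ∘ₗ
    cInd.single (KZ p) (symKZ (ZpBar p) r) g

/-- The reduction map from integral forms to `V_r / V_r^{(1)}`. -/
def redQuot (p : ℕ) [Fact p.Prime] (r : ℕ) :
    SymPow (ZpBar p) r →ₗ[ZpBar p] SymPow (FpBar p) r ⧸ thetaSub p (FpBar p) r 1 :=
  (thetaSub p (FpBar p) r 1).mkQ.restrictScalars (ZpBar p) ∘ₗ symMap (ZpBar p) (FpBar p) r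

theorem redQuot_surjective : Function.Surjective (redQuot p r) :=
  (Submodule.mkQ_surjective _).comp (symMap_surjective p r)

theorem redQuot_quotKZ (h : KZ p) (w : SymPow (ZpBar p) r) :
    quotKZ p (FpBar p) r 1 h (redQuot p r w) = redQuot p r (symKZ (ZpBar p) r h w) := by
  change (thetaSub p (FpBar p) r 1).mkQ (symAct (FpBar p) r _ (symMap (ZpBar p) (FpBar p) r w)) =
    (thetaSub p (FpBar p) r 1).mkQ (symMap (ZpBar p) (FpBar p) r (symAct (ZpBar p) r _ w))
  rw [symMap_symAct]

/-- If integral forms with reduction in `V_r^{(1)}` die in `Θ̄`, then `w ↦ [g, w]` factors through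
`V_r / V_r^{(1)}`. -/
def clsQuot (p : ℕ) [Fact p.Prime] (r : ℕ) (a : PadicAlgCl p)
    (hker : ∀ g, LinearMap.ker (redQuot p r) ≤ LinearMap.ker (clsBar p r a g))
    (g : GL (Fin 2) ℚ_[p]) :
    (SymPow (FpBar p) r ⧸ thetaSub p (FpBar p) r 1) →ₗ[FpBar p] ThetaBar p r a where
  toFun x := clsBar p r a g (Function.surjInv redQuot_surjective x)
  map_add' x y := by
    rw [← map_add, ← sub_eq_zero, ← map_sub]
    refine hker g ?_
    rw [LinearMap.mem_ker, map_sub, map_add]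
    simp only [Function.surjInv_eq, sub_self]
  map_smul' c x := by
    obtain ⟨c, rfl⟩ := IsLocalRing.residue_surjective c
    change _ = algebraMap (ZpBar p) (FpBar p) c • _
    rw [algebraMap_smul, ← map_smul, ← sub_eq_zero, ← map_sub]
    refine hker g ?_
    rw [LinearMap.mem_ker, map_sub, map_smul]
    simp only [Function.surjInv_eq]
    change algebraMap (ZpBar p) (FpBar p) c • x - c • x = 0
    rw [algebraMap_smul, sub_self]

theorem clsQuot_redQuot
    (hker : ∀ g, LinearMap.ker (redQuot p r) ≤ LinearMap.ker (clsBar p r a g))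
    (g : GL (Fin 2) ℚ_[p]) (w : SymPow (ZpBar p) r) :
    clsQuot p r a hker g (redQuot p r w) = clsBar p r a g w := by
  change clsBar p r a g (Function.surjInv redQuot_surjective _) = _
  rw [← sub_eq_zero, ← map_sub]
  refine hker g ?_
  rw [LinearMap.mem_ker, map_sub, Function.surjInv_eq redQuot_surjective, sub_self]

/-- A submodule of a compact induction that contains all elementary functions is everything. -/
theorem cInd_eq_top {R G W : Type*} [CommRing R] [Group G] (H : Subgroup G) [AddCommGroup W]
    [Module R W] (ρ : Representation R H W) (S : Submodule R (cInd H ρ))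
    (h : ∀ g w, cInd.single H ρ g w ∈ S) : S = ⊤ := by
  rw [← Submodule.ker_mkQ S, LinearMap.ker_eq_top]
  refine cInd.hom_ext H ρ fun g w => ?_
  rw [LinearMap.zero_apply, Submodule.mkQ_apply, Submodule.Quotient.mk_eq_zero]
  exact h g w

theorem thetaBarRep_clsBar (g g' : GL (Fin 2) ℚ_[p]) (w : SymPow (ZpBar p) r) :
    thetaBarRep p r a g (clsBar p r a g' w) = clsBar p r a (g * g') w := by
  change (1 : FpBar p) ⊗ₜ[ZpBar p] (thetaRep p r a g (toTheta p r a
    (cInd.single (KZ p) (symKZ (ZpBar p) r) g' w))) = (1 : FpBar p) ⊗ₜ[ZpBar p]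
    (toTheta p r a (cInd.single (KZ p) (symKZ (ZpBar p) r) (g * g') w))
  congr 1
  apply Subtype.ext
  change (heckeImage p (PadicAlgCl p) r a).mkQ (cInd.rep (KZ p) (symKZ (PadicAlgCl p) r) g
    (indMap (ZpBar p) (PadicAlgCl p) r (cInd.single (KZ p) (symKZ (ZpBar p) r) g' w))) =
    (heckeImage p (PadicAlgCl p) r a).mkQ (indMap (ZpBar p) (PadicAlgCl p) r
      (cInd.single (KZ p) (symKZ (ZpBar p) r) (g * g') w))
  rw [← indMap_rep, cInd.rep_single]

theorem exists_surjection
    (hker : ∀ g, LinearMap.ker (redQuot p r) ≤ LinearMap.ker (clsBar p r a g)) :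
    ∃ φ : cInd (KZ p) (quotKZ p (FpBar p) r 1) →ₗ[FpBar p] ThetaBar p r a,
      Function.Surjective φ ∧
      (∀ g f, φ (cInd.rep (KZ p) (quotKZ p (FpBar p) r 1) g f) = thetaBarRep p r a g (φ f)) ∧
      ∀ (g : GL (Fin 2) ℚ_[p]) (v : SymPow (ZpBar p) r),
        φ (cInd.single (KZ p) (quotKZ p (FpBar p) r 1) g (redQuot p r v)) = clsBar p r a g v := by
  have hΦ : ∀ (g : GL (Fin 2) ℚ_[p]) (h : KZ p) x, clsQuot p r a hker (g * h) x =
      clsQuot p r a hker g (quotKZ p (FpBar p) r 1 h x) := by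
    intro g h x
    obtain ⟨w, rfl⟩ := redQuot_surjective x
    rw [redQuot_quotKZ, clsQuot_redQuot, clsQuot_redQuot]
    exact congrArg (fun f => (1 : FpBar p) ⊗ₜ[ZpBar p] toTheta p r a f)
      (cInd.single_mul (KZ p) (symKZ (ZpBar p) r) g h w)
  let φ := cInd.lift (KZ p) (quotKZ p (FpBar p) r 1) (clsQuot p r a hker) hΦ
  have hφ : ∀ (g : GL (Fin 2) ℚ_[p]) (v : SymPow (ZpBar p) r),
      φ (cInd.single (KZ p) (quotKZ p (FpBar p) r 1) g (redQuot p r v)) = clsBar p r a g v :=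
    fun g v => by
      rw [cInd.lift_single (KZ p) (quotKZ p (FpBar p) r 1) _ hΦ, clsQuot_redQuot]
  refine ⟨φ, ?_, fun g f => ?_, hφ⟩
  · rw [← LinearMap.range_eq_top, eq_top_iff]
    rintro x -
    induction x using TensorProduct.induction_on with
    | zero => exact Submodule.zero_mem _
    | add x y hx hy => exact Submodule.add_mem _ hx hy
    | tmul c x =>
      have hS := cInd_eq_top (KZ p) (symKZ (ZpBar p) r)
        (((LinearMap.range φ).restrictScalars (ZpBar p)).comap
          (TensorProduct.mk (ZpBar p) (FpBar p) (Theta p r a) 1 ∘ₗ toTheta p r a))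
        fun g w => ⟨_, hφ g w⟩
      obtain ⟨_, f, rfl⟩ := x
      have hf : f ∈ (((LinearMap.range φ).restrictScalars (ZpBar p)).comap
          (TensorProduct.mk (ZpBar p) (FpBar p) (Theta p r a) 1 ∘ₗ toTheta p r a)) := by
        rw [hS]
        exact Submodule.mem_top
      have h1 : (1 : FpBar p) ⊗ₜ[ZpBar p] toTheta p r a f ∈ LinearMap.range φ := hf
      have h2 := Submodule.smul_mem _ c h1
      rwa [TensorProduct.smul_tmul', smul_eq_mul, mul_one] at h2
  · have h : φ ∘ₗ cInd.rep (KZ p) (quotKZ p (FpBar p) r 1) g = thetaBarRep p r a g ∘ₗ φ := by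
      refine cInd.hom_ext (KZ p) (quotKZ p (FpBar p) r 1) fun g' x => ?_
      obtain ⟨w, rfl⟩ := redQuot_surjective x
      rw [LinearMap.comp_apply, LinearMap.comp_apply, cInd.rep_single, hφ, hφ, thetaBarRep_clsBar]
    exact DFunLike.congr_fun h f

end Surjection

/-! ### From valuations to norms -/

section Valuation

variable {p : ℕ} [Fact p.Prime] {a : PadicAlgCl p}

theorem norm_sq_eq (ha0 : a ≠ 0) : ‖a‖ ^ 2 = (p : ℝ) ^ (-(2 * padicVal p a)) := by
  have hp : (1 : ℝ) < p := by exact_mod_cast (Fact.out : p.Prime).one_lt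
  have h : (p : ℝ) ^ (Real.logb p ‖a‖) = ‖a‖ :=
    Real.rpow_logb (by linarith) hp.ne' (norm_pos_iff.2 ha0)
  have e : -(2 * padicVal p a) = Real.logb p ‖a‖ * (2 : ℕ) := by
    rw [padicVal]; push_cast; ring
  rw [e, Real.rpow_mul_natCast (by linarith), h]

theorem inv_p_pow_eq {p : ℕ} (k : ℕ) : ((p : ℝ)⁻¹) ^ k = (p : ℝ) ^ (-(k : ℝ)) := by
  rw [Real.rpow_neg (Nat.cast_nonneg p), Real.rpow_natCast, inv_pow]

theorem inv_p_pow_le_norm_sq_iff (ha0 : a ≠ 0) (k : ℕ) :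
    ((p : ℝ)⁻¹) ^ k ≤ ‖a‖ ^ 2 ↔ 2 * padicVal p a ≤ k := by
  have hp : (1 : ℝ) < p := by exact_mod_cast (Fact.out : p.Prime).one_lt
  rw [norm_sq_eq ha0, inv_p_pow_eq, Real.rpow_le_rpow_left_iff hp, neg_le_neg_iff]

theorem inv_p_pow_lt_norm_sq_iff (ha0 : a ≠ 0) (k : ℕ) :
    ((p : ℝ)⁻¹) ^ k < ‖a‖ ^ 2 ↔ 2 * padicVal p a < k := by
  have hp : (1 : ℝ) < p := by exact_mod_cast (Fact.out : p.Prime).one_lt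
  rw [norm_sq_eq ha0, inv_p_pow_eq, Real.rpow_lt_rpow_left_iff hp, neg_lt_neg_iff]

theorem exists_admissible (ha0 : a ≠ 0) (ha : ‖a‖ < 1) {r b t : ℕ}
    (hr : r ≡ b [MOD p ^ t * (p - 1)])
    (hvb : 2 * padicVal p a ≤ b) (hb : b ≤ p - 1)
    (hcrit : 2 * padicVal p a = b →
      ∃ s : PadicAlgCl p, s ^ 2 = p ∧ ¬ ‖a / s ^ b - 1‖ < 1 ∧ ¬ ‖a / s ^ b + 1‖ < 1)
    (ht : 2 * padicVal p a - 1 < t) (hpr : p + 1 ≤ r) :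
    ∃ b τ n, Admissible p r b τ n a := by
  have hbr : b < r := by omega
  have hdvd : p ^ min t b * (p - 1) ∣ r - b :=
    (Nat.mul_dvd_mul_right (pow_dvd_pow p (min_le_left t b)) _).trans
      ((Nat.modEq_iff_dvd' hbr.le).1 hr.symm)
  obtain ⟨n, hn⟩ := hdvd
  refine ⟨b, min t b, n, ⟨by omega, ?_, min_le_right t b, hb, ha0, ha, ?_, ?_, ?_⟩⟩
  · rcases Nat.eq_zero_or_pos n with rfl | h
    · rw [mul_zero] at hn
      omega
    · exact h
  · rw [inv_p_pow_lt_norm_sq_iff ha0]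
    push_cast
    rcases min_choice (t : ℝ) b with h | h <;> rw [h] <;> linarith
  · exact (inv_p_pow_le_norm_sq_iff ha0 b).2 hvb
  · intro h
    have hv : 2 * padicVal p a = b :=
      le_antisymm hvb (not_lt.1 fun h' => ((inv_p_pow_lt_norm_sq_iff ha0 b).2 h').ne h)
    have htb : b ≤ t := by
      have h1 : (b : ℝ) < t + 1 := by linarith
      exact Nat.lt_succ_iff.1 (by exact_mod_cast h1)
    refine ⟨min_eq_right htb, ?_⟩
    obtain ⟨s, hs, h1, h2⟩ := hcrit hv
    have e : a ^ 2 / (p : PadicAlgCl p) ^ b - 1 = (a / s ^ b - 1) * (a / s ^ b + 1) := by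
      rw [← hs, ← pow_mul, mul_comm 2 b, pow_mul, ← div_pow]
      ring
    rw [e, norm_mul]
    exact one_le_mul_of_one_le_of_one_le (not_lt.1 h1) (not_lt.1 h2)

end Valuation

end

theorem mainTheorem3 (p : ℕ) [Fact p.Prime] (hp2 : p ≠ 2)
    (a : PadicAlgCl p) (ha0 : a ≠ 0) (ha : ‖a‖ < 1) (r b t : ℕ)
    (hr : r ≡ b [MOD p ^ t * (p - 1)])
    (hvb : 2 * padicVal p a ≤ b) (hb : b ≤ p - 1)
    (hcrit : 2 * padicVal p a = b →
      Odd b ∧ ∃ s : PadicAlgCl p, s ^ 2 = p ∧ ¬ ‖a / s ^ b - 1‖ < 1 ∧ ¬ ‖a / s ^ b + 1‖ < 1)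
    (ht : 2 * padicVal p a - 1 < t) :
    ∃ φ : cInd (KZ p) (quotKZ p (FpBar p) r 1) →ₗ[FpBar p] ThetaBar p r a,
      Function.Surjective φ ∧
      (∀ g f, φ (cInd.rep (KZ p) (quotKZ p (FpBar p) r 1) g f) = thetaBarRep p r a g (φ f)) ∧
      ∀ (g : GL (Fin 2) ℚ_[p]) (v : SymPow (ZpBar p) r),
        φ (cInd.single (KZ p) (quotKZ p (FpBar p) r 1) g
            ((thetaSub p (FpBar p) r 1).mkQ (symMap (ZpBar p) (FpBar p) r v))) =
          1 ⊗ₜ[ZpBar p] toTheta p r a (cInd.single (KZ p) (symKZ (ZpBar p) r) g v) := by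
  refine exists_surjection fun g w hw => one_tmul_eq_zero ?_
  have hw' : symMap (ZpBar p) (FpBar p) r w ∈ thetaSub p (FpBar p) r 1 :=
    (Submodule.Quotient.mk_eq_zero _).1 hw
  exact cls_mem_of_symMap_mem hp2
    (exists_admissible ha0 ha hr hvb hb (fun h => (hcrit h).2) ht) hw' g
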